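/- Let $k$ be an algebraically closed field of characteristic zero and let $X$ be a normal algebraic $k$-variety (a normal, separated, integral scheme of finite type over $k$) with generic point $\eta$ and function field $K$. A prime divisor $P$ of $X$ is identified with its generic point (a point of codimension one), and $\operatorname{Div}(X)$ denotes the group of Weil divisors, partially ordered coefficientwise; $D_P$ is the coefficient of $D$ at $P$. A reflexive sheaf on $X$ is a coherent $\mathcal O_X$-module $\mathcal E$ whose natural map $\mathcal E\to\mathcal E^{\vee\vee}$ is an isomorphism. For such $\mathcal E$ and $0\neq e\in\mathcal E_\eta$ there is a unique Weil divisor $D$ with $$\mathcal O_X(D)(U)=\{f\in K\mid f\cdot e\in\mathcal E(U)\subseteq\mathcal E_\eta\}\qquad\text{for all nonempty open }U\subseteq X,$$ where $\mathcal O_X(D)(U)=\{f\in K^*\mid (D+\operatorname{div}(f))|_U\ge 0\}\cup\{0\}$. The Weil decoration of $\mathcal E$ is the map $\mathcal W_{\mathcal E}\colon\mathcal E_\eta\to\operatorname{Div}(X)\cup\{\infty\}$ with $\mathcal W_{\mathcal E}(e)=D$ for $e\ne 0$ and $\mathcal W_{\mathcal E}(0)=\infty$; here $\infty$ is the largest element,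 and $\infty_P=\infty$. (i) Let $\mathcal E'\subseteq\mathcal E$ be reflexive sheaves with Weil decorations $\mathcal W'$ and $\mathcal W$, let $\mathcal E''=\mathcal E/\mathcal E'$ be the cokernel, and let $P$ be a prime divisor of $X$. Then the natural map $\mathcal E''_P\to\mathcal E''_\eta$ is injective if and only if $\mathcal W'(v)_P=\mathcal W(v)_P$ for all $v\in\mathcal E'_\eta$. In particular, if $\mathcal E'$ is the kernel of a morphism from $\mathcal E$ to some torsion-free sheaf (an $\mathcal O_X$-module all of whose stalks are torsion-free), then $\mathcal W'=\mathcal W|_{\mathcal E'_\eta}$. (ii) Let $\mu\colon\mathcal E\to\mathcal E'$ be a morphism of reflexive sheaves with Weil decorations $\mathcal W$ and $\mathcal W'$, and let $P$ be a prime divisor of $X$. Then $\mu_P\colon\mathcal E_P\to\mathcal E'_P$ is surjective if and only if for all $e'\in\mathcal E'_\eta$ $$\mathcal W'(e')_P=\max\{\mathcal W(e)_P\mid e\in\mathcal E_\eta,\ \mu_\eta(e)=e'\},$$ where the equality includes the claim that the maximum exists (so that, in particular, the set is nonempty). In particular, if $\mu$ is surjective, then for all $e'\in\mathcal E'_\eta$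 $$\mathcal W'(e')=\bigvee_{e\in\mu_\eta^{-1}(e')}\mathcal W(e),$$ that is, $\mathcal W'(e')$ is the least upper bound of the $\mathcal W(e)$, and for every prime divisor $P$ its coefficient at $P$ is the maximum of the $\mathcal W(e)_P$. -/

import Mathlib

open CategoryTheory AlgebraicGeometry Opposite

universe u

noncomputable section

namespace WeilDeco

/-- A normal algebraic variety over the field `k`: a normal, separated, integral scheme of
finite type over `k`. -/
structure NormalVariety (k : Type u) [Field k] where
  /-- the underlying scheme -/
  X : Scheme.{u}
  /-- the structure morphism -/
  str : X ⟶ Spec (CommRingCat.of k)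
  isIntegral : IsIntegral X
  isSeparated : IsSeparated str
  locallyOfFiniteType : LocallyOfFiniteType str
  quasiCompact : QuasiCompact str
  normal : ∀ x : X, IsIntegrallyClosed (X.presheaf.stalk x)

attribute [instance] NormalVariety.isIntegral NormalVariety.isSeparated
  NormalVariety.locallyOfFiniteType NormalVariety.quasiCompact NormalVariety.normal

instance {k : Type u} [Field k] (V : NormalVariety k) : IsLocallyNoetherian V.X :=
  LocallyOfFiniteType.isLocallyNoetherian V.str

section Sheaves

variable {X : Scheme.{u}}

/-- Sections of a presheaf of modules over `U` form a module over the commutative ring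
`Γ(X, U)`. -/
instance sectionsModule (M : X.PresheafOfModules) (U : X.Opens) :
    Module Γ(X, U) (M.obj (op U)) := (M.obj (op U)).isModule

/-- Restriction of sections of a presheaf of modules, as a semilinear map. -/
def resₛₗ (M : X.PresheafOfModules) {V W : X.Opens} (h : W ≤ V) :
    M.obj (op V) →ₛₗ[(X.presheaf.map (homOfLE h).op).hom] M.obj (op W) where
  toFun m := M.map (homOfLE h).op m
  map_add' a b := map_add (M.map (homOfLE h).op).hom a b
  map_smul' r m := PresheafOfModules.map_smul M (homOfLE h).op r m

lemma resₛₗ_resₛₗ (M : X.PresheafOfModules) {V W T : X.Opens} (h : W ≤ V) (h' : T ≤ W)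
    (m : M.obj (op V)) : resₛₗ M h' (resₛₗ M h m) = resₛₗ M (h'.trans h) m :=
  (PresheafOfModules.map_comp_apply M (homOfLE h).op (homOfLE h').op m).symm

lemma map_map_apply {V W T : X.Opens} (h : W ≤ V) (h' : T ≤ W) (r : Γ(X, V)) :
    X.presheaf.map (homOfLE h').op (X.presheaf.map (homOfLE h).op r) =
      X.presheaf.map (homOfLE (h'.trans h)).op r := by
  rw [← CommRingCat.comp_apply, ← X.presheaf.map_comp]
  rfl

/-- A section over `U` of the dual `ℋom(M, 𝒪_X)`, that is, a morphism `M|_U ⟶ 𝒪_X|_U` of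
presheaves of modules: linear maps `M(V) → 𝒪_X(V)` for all open `V ⊆ U`, compatible with
restriction. -/
@[ext]
structure DualSection (M : X.PresheafOfModules) (U : X.Opens) where
  /-- the linear map on sections over an open subset `V` of `U` -/
  app (V : X.Opens) (hV : V ≤ U) : M.obj (op V) →ₗ[Γ(X, V)] Γ(X, V)
  naturality (V W : X.Opens) (hV : V ≤ U) (hW : W ≤ V) (m : M.obj (op V)) :
    app W (hW.trans hV) (resₛₗ M hW m) = X.presheaf.map (homOfLE hW).op (app V hV m)

namespace DualSection

variable {M : X.PresheafOfModules} {U : X.Opens}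

instance : Zero (DualSection M U) where
  zero := ⟨fun _ _ => 0, fun _ _ _ _ _ => (map_zero _).symm⟩

instance : Add (DualSection M U) where
  add φ ψ := ⟨fun V hV => φ.app V hV + ψ.app V hV, fun V W hV hW m =>
    (congrArg₂ (· + ·) (φ.naturality V W hV hW m) (ψ.naturality V W hV hW m)).trans
      (map_add _ _ _).symm⟩

instance : Neg (DualSection M U) where
  neg φ := ⟨fun V hV => -φ.app V hV, fun V W hV hW m =>
    (congrArg (- ·) (φ.naturality V W hV hW m)).trans (map_neg _ _).symm⟩

instance : SMul Γ(X, U) (DualSection M U) where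
  smul r φ := ⟨fun V hV => X.presheaf.map (homOfLE hV).op r • φ.app V hV, fun V W hV hW m =>
    (congrArg₂ (· * ·) (map_map_apply hV hW r).symm (φ.naturality V W hV hW m)).trans
      (map_mul _ _ _).symm⟩

@[simp] lemma zero_app (V : X.Opens) (hV : V ≤ U) : (0 : DualSection M U).app V hV = 0 := rfl

@[simp] lemma add_app (φ ψ : DualSection M U) (V : X.Opens) (hV : V ≤ U) :
    (φ + ψ).app V hV = φ.app V hV + ψ.app V hV := rfl

@[simp] lemma neg_app (φ : DualSection M U) (V : X.Opens) (hV : V ≤ U) :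
    (-φ).app V hV = -φ.app V hV := rfl

@[simp] lemma smul_app (r : Γ(X, U)) (φ : DualSection M U) (V : X.Opens) (hV : V ≤ U) :
    (r • φ).app V hV = X.presheaf.map (homOfLE hV).op r • φ.app V hV := rfl

instance : AddCommGroup (DualSection M U) where
  add_assoc _ _ _ := by ext; simp [add_assoc]
  zero_add _ := by ext; simp
  add_zero _ := by ext; simp
  neg_add_cancel _ := by ext; simp
  add_comm _ _ := by ext; simp [add_comm]
  nsmul := nsmulRec
  zsmul := zsmulRec

instance : Module Γ(X, U) (DualSection M U) where
  one_smul _ := by ext; simp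
  mul_smul _ _ _ := by ext; simp [mul_assoc]
  smul_zero _ := by ext; simp
  smul_add _ _ _ := by ext; simp
  add_smul _ _ _ := by ext; simp [add_mul]
  zero_smul _ := by ext; simp

/-- Restriction of sections of the dual. -/
def res {V : X.Opens} (h : V ≤ U) : DualSection M U →+ DualSection M V where
  toFun φ := ⟨fun W hW => φ.app W (hW.trans h), fun W W' hW hW' m =>
    φ.naturality W W' (hW.trans h) hW' m⟩
  map_zero' := rfl
  map_add' _ _ := rfl

end DualSection

/-- The dual as a presheaf of abelian groups. -/
def dualPresheaf (M : X.PresheafOfModules) : X.Opensᵒᵖ ⥤ Ab.{u} where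
  obj U := AddCommGrpCat.of (DualSection M U.unop)
  map i := AddCommGrpCat.ofHom (DualSection.res i.unop.le)
  map_id _ := rfl
  map_comp _ _ := rfl

instance (M : X.PresheafOfModules) (U : X.Opensᵒᵖ) :
    Module (X.ringCatSheaf.obj.obj U) ((dualPresheaf M).obj U) :=
  inferInstanceAs (Module Γ(X, U.unop) (DualSection M U.unop))

/-- The dual `M^∨ = ℋom(M, 𝒪_X)` of a presheaf of `𝒪_X`-modules, with its
`𝒪_X`-module structure. (The dual of a presheaf of modules is automatically a sheaf, because
`𝒪_X` is one, so no sheafification is involved.) -/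
def dual (M : X.PresheafOfModules) : X.PresheafOfModules :=
  PresheafOfModules.ofPresheaf (dualPresheaf M) (fun {_ _} i r φ =>
    DualSection.ext (funext fun W => funext fun hW =>
      congrArg (· • (φ : DualSection M _).app W (hW.trans i.unop.le))
        (map_map_apply i.unop.le hW r).symm))

/-- The section of the double dual `(M^∨)^∨` over `U` given by evaluation at `m ∈ M(U)`: it
maps `φ ∈ M^∨(V)` to `φ_V(m|_V)`. -/
def evalSection (M : X.PresheafOfModules) (U : X.Opens) (m : M.obj (op U)) :
    DualSection (dual M) U where
  app V hV :=
    { toFun := fun φ : DualSection M V => φ.app V le_rfl (resₛₗ M hV m)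
      map_add' := fun _ _ => rfl
      map_smul' := fun r φ =>
        congrArg (· * (φ : DualSection M V).app V le_rfl (resₛₗ M hV m))
          (CategoryTheory.congr_fun (X.presheaf.map_id (op V)) r) }
  naturality V W hV hW φ :=
    (congrArg ((φ : DualSection M V).app W hW) (resₛₗ_resₛₗ M hV hW m).symm).trans
      ((φ : DualSection M V).naturality V W le_rfl hW (resₛₗ M hV m))

/-- The natural map `M ⟶ M^∨^∨` from a presheaf of modules to its double dual. -/
def toDoubleDual (M : X.PresheafOfModules) : M ⟶ dual (dual M) :=
  PresheafOfModules.homMk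
    { app := fun U => AddCommGrpCat.ofHom
        (AddMonoidHom.mk' (fun m : M.obj U => evalSection M U.unop m) (fun a b =>
          DualSection.ext (funext fun V => funext fun hV => LinearMap.ext fun φ =>
            (congrArg ((φ : DualSection M V).app V le_rfl) (map_add (resₛₗ M hV) a b)).trans
              (map_add ((φ : DualSection M V).app V le_rfl) _ _))))
      naturality := fun U V i => by
        apply AddCommGrpCat.hom_ext
        apply AddMonoidHom.ext
        intro m
        exact DualSection.ext (funext fun W => funext fun hW => LinearMap.ext fun φ =>
          congrArg ((φ : DualSection M W).app W le_rfl) (resₛₗ_resₛₗ M i.unop.le hW m)) }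
    (fun U r m => DualSection.ext (funext fun V => funext fun hV => LinearMap.ext fun φ =>
      (congrArg ((φ : DualSection M V).app V le_rfl) ((resₛₗ M hV).map_smulₛₗ r m)).trans
        (((φ : DualSection M V).app V le_rfl).map_smul _ _)))

/-- Coherent sheaves of modules (on a locally Noetherian scheme): quasi-coherent sheaves whose
sections over every affine open subset form a finitely generated module. -/
structure IsCoherent (E : X.Modules) : Prop where
  isQuasicoherent : E.IsQuasicoherent
  finite (U : X.Opens) (hU : IsAffineOpen U) : Module.Finite Γ(X, U) Γ(E, U)

/-- A reflexive sheaf: a coherent sheaf whose natural map to its double dual is an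
isomorphism. -/
structure IsReflexive (E : X.Modules) : Prop where
  isCoherent : IsCoherent E
  isIso_toDoubleDual : IsIso (toDoubleDual E.val)

/-- The stalk `E_x` of a sheaf of modules. -/
abbrev stalk (E : X.Modules) (x : X) : Ab.{u} := E.presheaf.stalk x

instance stalkModule (E : X.Modules) (x : X) : Module (X.presheaf.stalk x) (stalk E x) :=
  letI M : PresheafOfModules.{u} (X.presheaf ⋙ forget₂ CommRingCat.{u} RingCat.{u}) := E.val
  inferInstanceAs (Module (X.presheaf.stalk x) ↑(TopCat.Presheaf.stalk M.presheaf x))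

lemma germ_smul (E : X.Modules) (x : X) (U : X.Opens) (hx : x ∈ U) (r : Γ(X, U))
    (m : Γ(E, U)) :
    E.presheaf.germ U x hx (r • m) = X.presheaf.germ U x hx r • E.presheaf.germ U x hx m :=
  PresheafOfModules.germ_smul (R := X.presheaf) E.val x U hx r m

/-- A torsion-free sheaf: all stalks are torsion-free modules. -/
def IsTorsionFree (E : X.Modules) : Prop :=
  ∀ x : X, Module.IsTorsionFree (X.presheaf.stalk x) (stalk E x)

/-- The map `μ_x : E_x → E'_x` induced on stalks by a morphism of sheaves of modules. -/
def stalkMap {E E' : X.Modules} (μ : E ⟶ E') (x : X) : stalk E x ⟶ stalk E' x :=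
  (TopCat.Presheaf.stalkFunctor Ab.{u} x).map μ.mapPresheaf

end Sheaves

section Decorations

variable {X : Scheme.{u}} [IsIntegral X]

/-- The generic stalk `E_η`, a vector space over the function field `K = 𝒪_{X,η}`. -/
abbrev genericStalk (E : X.Modules) : Ab.{u} := stalk E (genericPoint X)

/-- The natural map `E_x → E_η` from a stalk to the generic stalk. -/
def toGenericStalk (E : X.Modules) (x : X) : stalk E x ⟶ genericStalk E :=
  E.presheaf.stalkSpecializes ((genericPoint_spec X).specializes trivial)

variable (X) in
/-- A prime divisor of `X`, given by its generic point, a point of codimension one. -/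
def PrimeDivisor : Type u := {P : X // Order.coheight P = 1}

variable (X) in
/-- The group `Div(X)` of Weil divisors: finite formal integral combinations of prime divisors,
with the coefficientwise partial order. -/
abbrev WeilDivisor : Type u := PrimeDivisor X →₀ ℤ

variable [IsLocallyNoetherian X]

/-- The sections of `𝒪_X(D)` over a nonempty open subset `U`, as a subset of the function
field: `0` and all `f ≠ 0` such that `D + div(f)` is effective on `U`. -/
def divisorSections (D : WeilDivisor X) (U : X.Opens) : Set X.functionField :=
  {f | f = 0 ∨ ∀ P : PrimeDivisor X, P.1 ∈ U → 0 ≤ D P + Scheme.ord f P.1}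

/-- The sections over `U` of `𝒦_E(e) = (1/e) ⬝ ((K ⬝ e) ∩ E)`, as a subset of the function
field: all `f` such that `f • e ∈ E_η` belongs to (the image of) `E(U)`. -/
def lineSections (E : X.Modules) (e : genericStalk E) (U : X.Opens)
    (hU : genericPoint X ∈ U) : Set X.functionField :=
  {f | ∃ s : Γ(E, U), E.presheaf.germ U (genericPoint X) hU s = f • e}

/-- `D` is the divisor of `e ∈ E_η`: `𝒪_X(D) = 𝒦_E(e)` as subsheaves of the constant sheaf `K`. -/
def IsDivisorOf (E : X.Modules) (e : genericStalk E) (D : WeilDivisor X) : Prop :=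
  ∀ (U : X.Opens) (hU : genericPoint X ∈ U), divisorSections D U = lineSections E e U hU

open Classical in
/-- The Weil decoration `𝒲_E` of `E`: it sends `e ≠ 0` to the unique Weil divisor `D` with
`𝒪_X(D) = 𝒦_E(e)`, and `0` to `∞`. (If `D` does not exist the value is meaningless; this
does not occur for reflexive `E` on a normal variety.) -/
def weilDecoration (E : X.Modules) (e : genericStalk E) : WithTop (WeilDivisor X) :=
  if e = 0 then ⊤
  else if h : ∃ D : WeilDivisor X, IsDivisorOf E e D then (h.choose : WeilDivisor X)
  else (0 : WeilDivisor X)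

/-- The coefficient of a divisor at `P`, with `∞_P = ∞`. -/
def coeff (P : PrimeDivisor X) (D : WithTop (WeilDivisor X)) : WithTop ℤ :=
  D.map (fun D' => D' P)

end Decorations

end WeilDeco

end

open WeilDeco

/-! At a prime divisor `P` the local ring is a discrete valuation ring. For `e ≠ 0` the functions
`f` with `f • e` in `E_P` form a fractional ideal, and the coefficient of the divisor of `e` at `P`
is minus the least order occurring in it. Coherence bounds this ideal from both sides uniformly on
each affine open, so almost all coefficients vanish (`IsCoherent.exists_weilDivisor`). Reflexivity
passes from codimension one to all opens: an element of `E_η` regular at every prime divisor of `U`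
defines, by evaluation, a section of the double dual over `U`, because rational functions regular in
codimension one are regular (`exists_section_of_forall_primeDivisor`).

Consequently the decoration at `P` and the stalk `E_P` inside `E_η` determine each other, and
inequalities between coefficients become inclusions between sets of multipliers
(`coeff_weilDecoration_le_iff`). Part (i) then says that equality of coefficients means `E'_P = E_P
∩ E'_η`, which is injectivity of `(E/E')_P → (E/E')_η`. In part (ii), an element is scaled by a
function of suitable order into the stalk, lifted there, and scaled back. The global statements
follow because kernels and epimorphisms of sheaves are exact on stalks. -/

/-- The ideal of denominators of an element `g` of an `A`-algebra. -/
def denominatorIdeal (A : Type*) {K : Type*} [CommRing A] [CommRing K] [Algebra A K] (g : K) :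
    Ideal A :=
  (LinearMap.range (Algebra.linearMap A K)).comap (LinearMap.toSpanSingleton A K g)

lemma mem_denominatorIdeal {A K : Type*} [CommRing A] [CommRing K] [Algebra A K] {g : K} {a : A} :
    a ∈ denominatorIdeal A g ↔ ∃ b, algebraMap A K b = algebraMap A K a * g := by
  simp [denominatorIdeal, Algebra.smul_def]

/-- A normal Noetherian domain is the intersection of its localizations at the primes of height
one. -/
theorem mem_range_algebraMap_of_height_one {A K : Type*} [CommRing A] [IsDomain A]
    [IsNoetherianRing A] [IsIntegrallyClosed A] [Field K] [Algebra A K] [IsFractionRing A K] (f : K)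
    (h : ∀ p : Ideal A, p.IsPrime → p.height = 1 →
      ∃ s ∉ p, ∃ a, algebraMap A K a = algebraMap A K s * f) :
    ∃ a, algebraMap A K a = f := by
  by_contra hf
  -- A maximal element of this family is an associated prime of `K/A`, the annihilator of the class
  -- of some multiple `g = c * f`.
  let S : Set (Ideal A) :=
    {I | ∃ c : A, (¬ ∃ a, algebraMap A K a = algebraMap A K c * f) ∧
      I = denominatorIdeal A (algebraMap A K c * f)}
  have hS : S.Nonempty := ⟨_, 1, by simpa using hf, rfl⟩
  obtain ⟨(p : Ideal A), ⟨c, hc, hp⟩, hmax⟩ := set_has_maximal_iff_noetherian.mpr ‹_› S hS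
  set g := algebraMap A K c * f with hg
  have mem_p {a : A} : a ∈ p ↔ ∃ b, algebraMap A K b = algebraMap A K a * g := by
    rw [hp, mem_denominatorIdeal]
  have hprime : p.IsPrime := by
    refine ⟨fun htop => hc ?_, fun {a b} hab => ?_⟩
    · have : (1 : A) ∈ p := htop ▸ Submodule.mem_top
      simpa using mem_p.mp this
    · by_contra! hcon
      refine hmax (denominatorIdeal A (algebraMap A K (a * c) * f)) ⟨a * c, ?_, rfl⟩ ?_
      · rw [map_mul, mul_assoc]
        exact fun h' => hcon.1 (mem_p.mpr h')
      · refine (SetLike.lt_iff_le_and_exists.mpr ⟨fun z hz => ?_, b, ?_, hcon.2⟩)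
        · obtain ⟨w, hw⟩ := mem_p.mp hz
          exact mem_denominatorIdeal.mpr ⟨a * w, by rw [map_mul, hw, hg, map_mul]; ring⟩
        · obtain ⟨w, hw⟩ := mem_p.mp hab
          exact mem_denominatorIdeal.mpr ⟨w, by rw [hw, hg, map_mul, map_mul]; ring⟩
  have hbot : p ≠ ⊥ := by
    obtain ⟨x, y, hy, hxy⟩ := IsFractionRing.div_surjective (A := A) g
    have hy0 : algebraMap A K y ≠ 0 := by
      simpa using nonZeroDivisors.ne_zero hy
    have : y ∈ p := mem_p.mpr ⟨x, by rw [← hxy]; field_simp⟩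
    exact fun h0 => nonZeroDivisors.ne_zero hy (by simpa [h0] using this)
  -- Otherwise `g` maps the nonzero finitely generated ideal `p` into itself, so `g` is integral
  -- over `A` and lies in `A` by normality.
  obtain ⟨y, hyp, u, hu, hup⟩ : ∃ y ∈ p, ∃ u, algebraMap A K u = algebraMap A K y * g ∧ u ∉ p := by
    by_contra! hcon
    refine hc ((IsIntegrallyClosed.isIntegral_iff (R := A) (K := K)).mp ?_)
    let N : Submodule A K := Submodule.map (Algebra.linearMap A K) p
    refine isIntegral_of_smul_mem_submodule (M := K) N ?_ ?_ g ?_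
    · obtain ⟨z, hz, hz0⟩ := Submodule.exists_mem_ne_zero_of_ne_bot hbot
      exact (Submodule.ne_bot_iff _).mpr ⟨algebraMap A K z, ⟨z, hz, rfl⟩, by simpa using hz0⟩
    · exact Submodule.FG.map _ (IsNoetherian.noetherian p)
    · rintro _ ⟨z, hz, rfl⟩
      obtain ⟨w, hw⟩ := mem_p.mp hz
      exact ⟨w, hcon z hz w hw, by simp [hw, mul_comm]⟩
  -- For `z ∈ p` with `w = z * g` one has `u * z = w * y`. A prime `q ⊆ p` containing `y` misses
  -- `u`, hence contains `z`. Krull's principal ideal theorem then bounds the height of `p`.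
  have hmin : p ∈ (Ideal.span {y}).minimalPrimes := by
    refine ⟨⟨hprime, by simpa [Ideal.span_le] using hyp⟩, fun q ⟨hq, hyq⟩ hqp z hz => ?_⟩
    obtain ⟨w, hw⟩ := mem_p.mp hz
    have : u * z = w * y := by
      apply IsFractionRing.injective A K
      rw [map_mul, map_mul, hu, hw]; ring
    refine (hq.mem_or_mem (x := u) (y := z) ?_).resolve_left fun huq => hup (hqp huq)
    rw [this]
    exact q.mul_mem_left _ (hyq (Ideal.mem_span_singleton_self y))
  have hht : p.height = 1 := by
    refine le_antisymm (Ideal.height_le_one_of_isPrincipal_of_mem_minimalPrimes _ p hmin) ?_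
    rw [Order.one_le_iff_ne_zero, Ne, Ideal.height_eq_zero_iff_eq_bot]
    exact hbot
  obtain ⟨s, hs, a, ha⟩ := h p hprime hht
  exact hs (mem_p.mpr ⟨c * a, by rw [map_mul, ha, hg]; ring⟩)

namespace WeilDeco

/-! ### Affine charts, codimension and prime divisors. -/

section Schemes

variable {X : Scheme.{u}}

lemma isUnit_germ_iff {U : X.Opens} (hU : IsAffineOpen U) {x : X} (hx : x ∈ U) (a : Γ(X, U)) :
    IsUnit (X.presheaf.germ U x hx a) ↔ a ∉ (hU.primeIdealOf ⟨x, hx⟩).asIdeal := by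
  let := TopCat.Presheaf.algebra_section_stalk X.presheaf ⟨x, hx⟩
  have := hU.isLocalization_stalk ⟨x, hx⟩
  exact IsLocalization.AtPrime.isUnit_to_map_iff (X.presheaf.stalk x)
    (hU.primeIdealOf ⟨x, hx⟩).asIdeal a

lemma exists_germ_mul_eq {U : X.Opens} (hU : IsAffineOpen U) {x : X} (hx : x ∈ U)
    (m : X.presheaf.stalk x) : ∃ a s : Γ(X, U), IsUnit (X.presheaf.germ U x hx a) ∧
      X.presheaf.germ U x hx a * m = X.presheaf.germ U x hx s := by
  let := TopCat.Presheaf.algebra_section_stalk X.presheaf ⟨x, hx⟩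
  have := hU.isLocalization_stalk ⟨x, hx⟩
  obtain ⟨⟨s, a⟩, h⟩ := IsLocalization.surj (hU.primeIdealOf ⟨x, hx⟩).asIdeal.primeCompl m
  exact ⟨a, s, (isUnit_germ_iff hU hx a).mpr a.2, (mul_comm _ _).trans h⟩

lemma height_primeIdealOf {U : X.Opens} (hU : IsAffineOpen U) {x : X} (hx : x ∈ U) :
    (hU.primeIdealOf ⟨x, hx⟩).asIdeal.height = Order.coheight x := by
  have h1 := idealHeight_eq_coheight Γ(X, U) (hU.primeIdealOf ⟨x, hx⟩)
  have h2 := coheight_eq_of_isOpenImmersion (x := hU.primeIdealOf ⟨x, hx⟩) hU.fromSpec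
  exact h1.trans (h2.symm.trans (congrArg Order.coheight (hU.fromSpec_primeIdealOf ⟨x, hx⟩)))

lemma exists_primeIdealOf_eq {U : X.Opens} (hU : IsAffineOpen U) (p : PrimeSpectrum Γ(X, U)) :
    ∃ (x : X) (hx : x ∈ U), hU.primeIdealOf ⟨x, hx⟩ = p := by
  have hx : hU.fromSpec p ∈ U := by
    rw [← SetLike.mem_coe, ← hU.range_fromSpec]; exact Set.mem_range_self p
  refine ⟨hU.fromSpec p, hx, ?_⟩
  exact hU.fromSpec.isOpenEmbedding.injective (hU.fromSpec_primeIdealOf ⟨_, hx⟩)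

lemma exists_isAffineOpen_mem_le {U : X.Opens} {x : X} (hx : x ∈ U) :
    ∃ V : X.Opens, IsAffineOpen V ∧ x ∈ V ∧ V ≤ U := by
  obtain ⟨_, ⟨V, hV, rfl⟩, hxV, hVU⟩ :=
    X.isBasis_affineOpens.exists_subset_of_mem_open hx U.isOpen
  exact ⟨V, hV, hxV, hVU⟩

lemma germ_res_apply' {U V : X.Opens} (h : V ≤ U) {x : X} (hx : x ∈ V) (s : Γ(X, U)) :
    X.presheaf.germ V x hx (X.presheaf.map (homOfLE h).op s) = X.presheaf.germ U x (h hx) s :=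
  X.presheaf.germ_res_apply (homOfLE h) x hx s

lemma exists_isAffineOpen_cover [CompactSpace X] :
    ∃ S : Set X.affineOpens, S.Finite ∧ ∀ x, ∃ U ∈ S, x ∈ U.1 := by
  obtain ⟨S, hS, h⟩ := isCompact_and_isOpen_iff_finite_and_eq_biUnion_affineOpens.mp
    ⟨isCompact_univ (X := X), isOpen_univ⟩
  exact ⟨S, hS, fun x => by simpa using Set.ext_iff.mp h x⟩

/-- Remove the closures of the divisors in `B`: two points of the same finite codimension cannot
properly specialize to one another. -/
lemma exists_open_of_finite {B : Set (PrimeDivisor X)} (hB : B.Finite) {P : PrimeDivisor X}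
    (hP : P ∉ B) : ∃ U : X.Opens, P.1 ∈ U ∧ ∀ Q ∈ B, Q.1 ∉ U := by
  refine ⟨⟨(⋃ Q ∈ B, closure {Q.1})ᶜ, (hB.isClosed_biUnion fun _ _ => isClosed_closure).isOpen_compl⟩,
    ?_, fun Q hQ hQ' => hQ' (Set.mem_biUnion hQ (subset_closure rfl))⟩
  intro h
  obtain ⟨Q, hQ, h⟩ := Set.mem_iUnion₂.mp h
  have hle : P.1 ≤ Q.1 := specializes_iff_mem_closure.mpr h
  have hnle : ¬ Q.1 ≤ P.1 := fun h' => hP ((Subtype.ext (Specializes.antisymm h' hle).eq : P = Q) ▸ hQ)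
  have := Order.coheight_add_one_le (lt_of_le_not_ge hle hnle)
  rw [P.2, Q.2] at this
  exact absurd this (by decide)

end Schemes

/-! ### Regular functions on a normal integral scheme. -/

section Rings

variable {X : Scheme.{u}} [IsIntegral X]

lemma genericPoint_mem {U : X.Opens} {x : X} (hx : x ∈ U) : genericPoint X ∈ U :=
  ((genericPoint_spec X).mem_open_set_iff U.isOpen).mpr ⟨x, trivial, hx⟩

lemma algebraMap_germ {U : X.Opens} {x : X} (hx : x ∈ U) (hη : genericPoint X ∈ U) (s : Γ(X, U)) :
    algebraMap (X.presheaf.stalk x) X.functionField (X.presheaf.germ U x hx s) =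
      X.presheaf.germ U (genericPoint X) hη s :=
  have : Nonempty U := ⟨⟨_, hη⟩⟩
  Scheme.algebraMap_germ_eq_germToFunctionField X hx s

lemma isIntegrallyClosed_of_isAffineOpen [∀ x : X, IsIntegrallyClosed (X.presheaf.stalk x)]
    {U : X.Opens} (hU : IsAffineOpen U) [Nonempty U] : IsIntegrallyClosed Γ(X, U) := by
  refine IsIntegrallyClosed.of_localization_maximal fun p _ hp => ?_
  obtain ⟨x, hx, h⟩ := exists_primeIdealOf_eq hU ⟨p, hp.isPrime⟩
  let := TopCat.Presheaf.algebra_section_stalk X.presheaf ⟨x, hx⟩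
  have := hU.isLocalization_stalk ⟨x, hx⟩
  have hp' : (hU.primeIdealOf ⟨x, hx⟩).asIdeal = p := congrArg PrimeSpectrum.asIdeal h
  subst hp'
  exact .of_equiv (IsLocalization.algEquiv (hU.primeIdealOf ⟨x, hx⟩).asIdeal.primeCompl
    (X.presheaf.stalk x) (Localization.AtPrime (hU.primeIdealOf ⟨x, hx⟩).asIdeal)).toRingEquiv

/-- Rational functions on a normal scheme that are regular in codimension one are regular: the
affine case. -/
lemma exists_germ_eq_of_isAffineOpen [IsLocallyNoetherian X]
    [∀ x : X, IsIntegrallyClosed (X.presheaf.stalk x)] {U : X.Opens} (hU : IsAffineOpen U)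
    (hη : genericPoint X ∈ U) (f : X.functionField)
    (h : ∀ P : PrimeDivisor X, P.1 ∈ U → ∃ a : X.presheaf.stalk P.1,
      algebraMap (X.presheaf.stalk P.1) X.functionField a = f) :
    ∃ s : Γ(X, U), X.presheaf.germ U (genericPoint X) hη s = f := by
  have : Nonempty U := ⟨⟨_, hη⟩⟩
  have := isIntegrallyClosed_of_isAffineOpen hU
  have := functionField_isFractionRing_of_isAffineOpen X U hU
  have : IsNoetherianRing Γ(X, U) := IsLocallyNoetherian.component_noetherian ⟨U, hU⟩
  refine mem_range_algebraMap_of_height_one (A := Γ(X, U)) f fun p hp hp1 => ?_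
  obtain ⟨x, hx, hxp⟩ := exists_primeIdealOf_eq hU ⟨p, hp⟩
  have hp' : (hU.primeIdealOf ⟨x, hx⟩).asIdeal = p := congrArg PrimeSpectrum.asIdeal hxp
  obtain ⟨m, hm⟩ := h ⟨x, by rw [← height_primeIdealOf hU hx, hp', hp1]⟩ hx
  obtain ⟨a, s, ha, has⟩ := exists_germ_mul_eq hU hx m
  refine ⟨a, hp' ▸ (isUnit_germ_iff hU hx a).mp ha, s, ?_⟩
  have := congrArg (algebraMap (X.presheaf.stalk x) X.functionField) has
  rw [map_mul, hm, algebraMap_germ hx hη, algebraMap_germ hx hη] at this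
  exact this.symm

/-- Quantifying over `hη` lets the empty open set be included: there the hypothesis is vacuous and
all sections agree anyway. -/
lemma eq_of_germ_eq {U : X.Opens} {s t : Γ(X, U)}
    (h : ∀ hη : genericPoint X ∈ U, X.presheaf.germ U (genericPoint X) hη s =
      X.presheaf.germ U (genericPoint X) hη t) : s = t := by
  by_cases hU : ∃ x, x ∈ U
  · obtain ⟨x, hx⟩ := hU
    exact germ_injective_of_isIntegral X _ (genericPoint_mem hx) (h (genericPoint_mem hx))
  · exact TopCat.Presheaf.section_ext X.sheaf U s t fun x hx => absurd ⟨x, hx⟩ hU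

/-- Rational functions on a normal scheme that are regular in codimension one are regular. -/
lemma exists_germ_eq_of_forall_primeDivisor [IsLocallyNoetherian X]
    [∀ x : X, IsIntegrallyClosed (X.presheaf.stalk x)] {U : X.Opens}
    (hη : genericPoint X ∈ U) (f : X.functionField)
    (h : ∀ P : PrimeDivisor X, P.1 ∈ U → ∃ a : X.presheaf.stalk P.1,
      algebraMap (X.presheaf.stalk P.1) X.functionField a = f) :
    ∃ s : Γ(X, U), X.presheaf.germ U (genericPoint X) hη s = f := by
  choose V hV hxV hVU using fun x : U => exists_isAffineOpen_mem_le x.2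
  choose s hs using fun x : U => exists_germ_eq_of_isAffineOpen (hV x) (genericPoint_mem (hxV x)) f
    fun P hP => h P (hVU x hP)
  obtain ⟨t, ht, -⟩ := X.sheaf.existsUnique_gluing' V U (fun x => homOfLE (hVU x))
    (fun x hx => TopologicalSpace.Opens.mem_iSup.mpr ⟨⟨x, hx⟩, hxV ⟨x, hx⟩⟩) s (fun x y => by
      refine eq_of_germ_eq fun hη' => ?_
      refine (X.presheaf.germ_res_apply (TopologicalSpace.Opens.infLELeft (V x) (V y)) _ hη' _).trans
        (Eq.trans ?_ (X.presheaf.germ_res_apply (TopologicalSpace.Opens.infLERight (V x) (V y)) _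
          hη' _).symm)
      exact (hs x).trans (hs y).symm)
  refine ⟨t, ?_⟩
  rw [← hs ⟨_, hη⟩, ← ht ⟨_, hη⟩]
  exact (germ_res_apply' (hVU ⟨_, hη⟩) _ t).symm

end Rings

/-! ### Orders of vanishing along prime divisors. -/

section Orders

variable {X : Scheme.{u}} [IsIntegral X] [IsLocallyNoetherian X]

lemma isDiscreteValuationRing_stalk [∀ x : X, IsIntegrallyClosed (X.presheaf.stalk x)]
    (P : PrimeDivisor X) : IsDiscreteValuationRing (X.presheaf.stalk P.1) := by
  have hle : Ring.KrullDimLE 1 (X.presheaf.stalk P.1) := krullDimLE_of_coheight_le P.2.le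
  have hfield : ¬ IsField (X.presheaf.stalk P.1) := fun h => by
    have h0 := ringKrullDim_eq_zero_of_isField h
    rw [ringKrullDim_stalk_eq_coheight, P.2] at h0
    exact one_ne_zero (α := WithBot ℕ∞) h0
  have hdim : Ring.DimensionLEOne (X.presheaf.stalk P.1) :=
    ⟨fun {p} hp hp' => Ring.krullDimLE_one_iff_of_noZeroDivisors.mp hle p hp hp'⟩
  have : IsDedekindDomain (X.presheaf.stalk P.1) := { }
  exact ((IsDiscreteValuationRing.TFAE _ hfield).out 2 0).mp this

lemma ordHom_eq_ordFrac (P : PrimeDivisor X) [IsDiscreteValuationRing (X.presheaf.stalk P.1)]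
    (f : X.functionField) :
    X.ordHom P.1 P.2 f = Ring.ordFrac (X.presheaf.stalk P.1) f := rfl

lemma zero_le_ord_iff [∀ x : X, IsIntegrallyClosed (X.presheaf.stalk x)] (P : PrimeDivisor X)
    {f : X.functionField} (hf : f ≠ 0) : 0 ≤ Scheme.ord f P.1 ↔
      ∃ a : X.presheaf.stalk P.1, algebraMap (X.presheaf.stalk P.1) X.functionField a = f := by
  have := isDiscreteValuationRing_stalk P
  rw [Scheme.le_ord_iff P.2 hf, ordHom_eq_ordFrac, Ring.ordFrac_eq_valuation_inv, ofAdd_zero,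
    WithZero.coe_one, one_le_inv₀]
  · refine ⟨IsDiscreteValuationRing.exists_lift_of_le_one, ?_⟩
    rintro ⟨a, rfl⟩
    exact IsDedekindDomain.HeightOneSpectrum.valuation_le_one _ _
  · simpa [WithZero.pos_iff_ne_zero] using hf

lemma ord_inv (P : PrimeDivisor X) {f : X.functionField} (hf : f ≠ 0) :
    Scheme.ord f⁻¹ P.1 = - Scheme.ord f P.1 := by
  have h1 : Scheme.ord (1 : X.functionField) P.1 = 0 := by
    have := Scheme.ord_mul (x := P.1) (one_ne_zero (α := X.functionField)) one_ne_zero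
    rw [mul_one] at this
    lia
  have := Scheme.ord_mul (x := P.1) hf (inv_ne_zero hf)
  rw [mul_inv_cancel₀ hf, h1] at this
  lia

lemma exists_ord_eq [∀ x : X, IsIntegrallyClosed (X.presheaf.stalk x)] (P : PrimeDivisor X)
    (n : ℤ) : ∃ f : X.functionField, f ≠ 0 ∧ Scheme.ord f P.1 = n := by
  have := isDiscreteValuationRing_stalk P
  obtain ⟨ϖ, hϖ⟩ := IsDiscreteValuationRing.exists_irreducible (X.presheaf.stalk P.1)
  have h0 : algebraMap (X.presheaf.stalk P.1) X.functionField ϖ ≠ 0 := by simpa using hϖ.ne_zero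
  refine ⟨algebraMap (X.presheaf.stalk P.1) X.functionField ϖ ^ n, zpow_ne_zero _ h0, ?_⟩
  rw [Scheme.ord_eq_iff P.2 (zpow_ne_zero _ h0), map_zpow₀, ordHom_eq_ordFrac,
    Ring.ordFrac_irreducible hϖ, ← WithZero.exp_zsmul]
  simp [WithZero.exp]

lemma ord_germ_of_isUnit {U : X.Opens} (hη : genericPoint X ∈ U) {a : Γ(X, U)}
    {P : PrimeDivisor X} (hP : P.1 ∈ U) (ha : IsUnit (X.presheaf.germ U P.1 hP a)) :
    Scheme.ord (X.presheaf.germ U (genericPoint X) hη a) P.1 = 0 := by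
  have : Ring.KrullDimLE 1 (X.presheaf.stalk P.1) := krullDimLE_of_coheight_le P.2.le
  rw [← algebraMap_germ hP, Scheme.ord_eq_iff P.2]
  · exact Ring.ordFrac_of_isUnit ha
  · simpa using ha.ne_zero

/-- A height one prime containing `a ≠ 0` is minimal over `(a)`, and a Noetherian ring has finitely
many such primes. -/
lemma finite_not_isUnit_germ {U : X.Opens} (hU : IsAffineOpen U) {a : Γ(X, U)} (ha : a ≠ 0) :
    {P : PrimeDivisor X | ∃ hP : P.1 ∈ U, ¬ IsUnit (X.presheaf.germ U P.1 hP a)}.Finite := by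
  have : IsNoetherianRing Γ(X, U) := IsLocallyNoetherian.component_noetherian ⟨U, hU⟩
  by_cases hne : Nonempty U
  swap
  · exact Set.finite_empty.subset fun P ⟨hP, _⟩ => (hne ⟨⟨_, hP⟩⟩).elim
  have hfin := Ideal.finite_minimalPrimes_of_isNoetherianRing Γ(X, U) (Ideal.span {a})
  classical
  let φ : PrimeDivisor X → Ideal Γ(X, U) := fun P =>
    if hP : P.1 ∈ U then (hU.primeIdealOf ⟨P.1, hP⟩).asIdeal else ⊤
  refine Set.Finite.of_finite_image (f := φ) (hfin.subset ?_) ?_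
  · rintro _ ⟨P, ⟨hP, h⟩, rfl⟩
    rw [isUnit_germ_iff hU hP, not_not] at h
    have hht : (hU.primeIdealOf ⟨P.1, hP⟩).asIdeal.height = 1 := by
      rw [height_primeIdealOf hU hP, P.2]
    simp only [φ, dif_pos hP]
    have hp := (hU.primeIdealOf ⟨P.1, hP⟩).isPrime
    refine ⟨⟨hp, by simpa [Ideal.span_le] using h⟩, fun q ⟨hq, haq⟩ hqp => ?_⟩
    by_contra hcon
    have hlt : q.height < 1 :=
      hht ▸ Ideal.height_strict_mono_of_isPrime_of_isPrime (lt_of_le_not_ge hqp hcon)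
    rw [Order.lt_one_iff, Ideal.height_eq_zero_iff_eq_bot] at hlt
    exact ha (by simpa [hlt] using haq (Ideal.mem_span_singleton_self a))
  · rintro P ⟨hP, _⟩ Q ⟨hQ, _⟩ h
    simp only [φ, dif_pos hP, dif_pos hQ] at h
    have h' : hU.primeIdealOf ⟨P.1, hP⟩ = hU.primeIdealOf ⟨Q.1, hQ⟩ := PrimeSpectrum.ext h
    have := congrArg hU.fromSpec h'
    rw [hU.fromSpec_primeIdealOf, hU.fromSpec_primeIdealOf] at this
    exact Subtype.ext this

lemma finite_ord_ne_zero [CompactSpace X] {f : X.functionField} (hf : f ≠ 0) :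
    {P : PrimeDivisor X | Scheme.ord f P.1 ≠ 0}.Finite := by
  obtain ⟨S, hS, hcov⟩ := exists_isAffineOpen_cover (X := X)
  have key (U : X.affineOpens) : {P : PrimeDivisor X | P.1 ∈ U.1 ∧ Scheme.ord f P.1 ≠ 0}.Finite := by
    by_cases hη : genericPoint X ∈ U.1
    swap
    · exact Set.finite_empty.subset fun P ⟨hP, _⟩ => (hη (genericPoint_mem hP)).elim
    obtain ⟨a, s, ha, has⟩ := exists_germ_mul_eq U.2 hη f
    have ha0 : a ≠ 0 := by
      rintro rfl
      exact not_isUnit_zero ((map_zero (X.presheaf.germ U.1 _ hη).hom) ▸ ha)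
    have hs0 : s ≠ 0 := by
      rintro rfl
      rw [map_zero] at has
      exact (mul_ne_zero ha.ne_zero hf) has
    refine ((finite_not_isUnit_germ U.2 ha0).union
      (finite_not_isUnit_germ U.2 hs0)).subset fun P ⟨hP, hne⟩ => ?_
    by_contra hcon
    simp only [Set.mem_union, Set.mem_ofPred_eq, not_or, not_exists, not_not] at hcon
    apply hne
    have := congrArg (fun g => Scheme.ord (X := X) g P.1) has
    simp only at this
    rw [Scheme.ord_mul ha.ne_zero hf, ord_germ_of_isUnit hη hP (hcon.1 hP),
      ord_germ_of_isUnit hη hP (hcon.2 hP)] at this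
    lia
  refine (hS.biUnion fun U _ => key U).subset fun P hP => ?_
  obtain ⟨U, hU, hPU⟩ := hcov P.1
  exact Set.mem_biUnion hU ⟨hPU, hP⟩

end Orders

/-! ### Stalks of modules and regularity of elements of the generic stalk. -/

section Stalks

variable {X : Scheme.{u}}

lemma exists_germ_eq (E : X.Modules) {x : X} {U : X.Opens} (hx : x ∈ U) (m : stalk E x) :
    ∃ (V : X.Opens) (_ : V ≤ U) (hxV : x ∈ V) (s : Γ(E, V)), E.presheaf.germ V x hxV s = m := by
  obtain ⟨W, hxW, s, rfl⟩ := TopCat.Presheaf.exists_germ_eq E.presheaf m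
  exact ⟨U ⊓ W, inf_le_left, ⟨hx, hxW⟩, E.presheaf.map (homOfLE inf_le_right).op s,
    E.presheaf.germ_res_apply (homOfLE inf_le_right) x _ s⟩

lemma module_germ_res (E : X.Modules) {U V : X.Opens} (h : V ≤ U) {x : X} (hx : x ∈ V)
    (s : Γ(E, U)) : E.presheaf.germ V x hx (E.presheaf.map (homOfLE h).op s) =
      E.presheaf.germ U x (h hx) s :=
  E.presheaf.germ_res_apply (homOfLE h) x hx s

lemma exists_common_germ_eq (E : X.Modules) {x : X} (r : X.presheaf.stalk x) (m : stalk E x) :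
    ∃ (V : X.Opens) (hxV : x ∈ V) (r' : Γ(X, V)) (s : Γ(E, V)),
      X.presheaf.germ V x hxV r' = r ∧ E.presheaf.germ V x hxV s = m := by
  obtain ⟨W, hxW, r', rfl⟩ := TopCat.Presheaf.exists_germ_eq X.presheaf r
  obtain ⟨V, hV, hxV, s, rfl⟩ := exists_germ_eq E hxW m
  exact ⟨V, hxV, X.presheaf.map (homOfLE hV).op r', s, germ_res_apply' hV hxV r', rfl⟩

lemma stalkMap_germ {E E' : X.Modules} (μ : E ⟶ E') {U : X.Opens} {x : X} (hx : x ∈ U)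
    (s : Γ(E, U)) :
    stalkMap μ x (E.presheaf.germ U x hx s) = E'.presheaf.germ U x hx (μ.app U s) :=
  TopCat.Presheaf.stalkFunctor_map_germ_apply U x hx μ.mapPresheaf s

lemma stalkMap_smul {E E' : X.Modules} (μ : E ⟶ E') {x : X} (r : X.presheaf.stalk x)
    (m : stalk E x) : stalkMap μ x (r • m) = r • stalkMap μ x m := by
  obtain ⟨V, hxV, r, s, rfl, rfl⟩ := exists_common_germ_eq E r m
  rw [← germ_smul, stalkMap_germ, stalkMap_germ, ← germ_smul, Scheme.Modules.Hom.app_smul]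

variable [IsIntegral X]

lemma toGenericStalk_germ (E : X.Modules) {U : X.Opens} {x : X} (hx : x ∈ U)
    (hη : genericPoint X ∈ U) (s : Γ(E, U)) :
    toGenericStalk E x (E.presheaf.germ U x hx s) = E.presheaf.germ U (genericPoint X) hη s :=
  E.presheaf.germ_stalkSpecializes_apply hx ((genericPoint_spec X).specializes trivial) s

lemma toGenericStalk_smul (E : X.Modules) {x : X} (r : X.presheaf.stalk x) (m : stalk E x) :
    toGenericStalk E x (r • m) =
      algebraMap (X.presheaf.stalk x) X.functionField r • toGenericStalk E x m := by
  obtain ⟨V, hxV, r, s, rfl, rfl⟩ := exists_common_germ_eq E r m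
  rw [← germ_smul, toGenericStalk_germ E hxV (genericPoint_mem hxV),
    toGenericStalk_germ E hxV (genericPoint_mem hxV), germ_smul,
    algebraMap_germ hxV (genericPoint_mem hxV)]

lemma stalkMap_toGenericStalk {E E' : X.Modules} (μ : E ⟶ E') {x : X} (m : stalk E x) :
    stalkMap μ (genericPoint X) (toGenericStalk E x m) =
      toGenericStalk E' x (stalkMap μ x m) := by
  obtain ⟨V, -, hxV, s, rfl⟩ := exists_germ_eq E (U := ⊤) trivial m
  rw [toGenericStalk_germ E hxV (genericPoint_mem hxV), stalkMap_germ, stalkMap_germ,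
    toGenericStalk_germ E' hxV (genericPoint_mem hxV)]

/-- An element of the generic stalk is regular at `x` if it comes from the stalk at `x`. -/
def IsRegularAt (E : X.Modules) (x : X) (e : genericStalk E) : Prop :=
  ∃ m : stalk E x, toGenericStalk E x m = e

lemma IsRegularAt.smul {E : X.Modules} {x : X} {e : genericStalk E} (h : IsRegularAt E x e)
    (r : X.presheaf.stalk x) :
    IsRegularAt E x (algebraMap (X.presheaf.stalk x) X.functionField r • e) := by
  obtain ⟨m, rfl⟩ := h
  exact ⟨r • m, toGenericStalk_smul E r m⟩

lemma isRegularAt_zero (E : X.Modules) (x : X) : IsRegularAt E x 0 := ⟨0, map_zero _⟩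

lemma IsRegularAt.stalkMap {E E' : X.Modules} (μ : E ⟶ E') {x : X} {e : genericStalk E}
    (h : IsRegularAt E x e) : IsRegularAt E' x (stalkMap μ (genericPoint X) e) := by
  obtain ⟨m, rfl⟩ := h
  exact ⟨WeilDeco.stalkMap μ x m, (stalkMap_toGenericStalk μ m).symm⟩

lemma isRegularAt_germ (E : X.Modules) {U : X.Opens} {x : X} (hx : x ∈ U)
    (hη : genericPoint X ∈ U) (s : Γ(E, U)) :
    IsRegularAt E x (E.presheaf.germ U (genericPoint X) hη s) :=
  ⟨_, toGenericStalk_germ E hx hη s⟩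

lemma IsRegularAt.exists_germ_eq {E : X.Modules} {x : X} {e : genericStalk E}
    (h : IsRegularAt E x e) {U : X.Opens} (hx : x ∈ U) :
    ∃ (V : X.Opens) (_ : V ≤ U) (hxV : x ∈ V) (s : Γ(E, V)),
      E.presheaf.germ V (genericPoint X) (genericPoint_mem hxV) s = e := by
  obtain ⟨m, rfl⟩ := h
  obtain ⟨V, hV, hxV, s, rfl⟩ := WeilDeco.exists_germ_eq E hx m
  exact ⟨V, hV, hxV, s, (toGenericStalk_germ E hxV _ s).symm⟩

lemma inv_smul_smul_genericStalk {E : X.Modules} {f : X.functionField} (hf : f ≠ 0)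
    (e : genericStalk E) : f⁻¹ • f • e = e := by
  rw [← mul_smul, inv_mul_cancel₀ hf, one_smul]

lemma smul_ne_zero_genericStalk {E : X.Modules} {f : X.functionField} (hf : f ≠ 0)
    {e : genericStalk E} (he : e ≠ 0) : f • e ≠ 0 := fun h => he (by
  rw [← inv_smul_smul_genericStalk hf e, h, smul_zero])

end Stalks

/-! ### Stalks of quasi-coherent sheaves as localizations of sections over affine opens. -/

section Quasicoherent

variable {X : Scheme.{u}}

lemma image_fromSpec_le {U : X.Opens} (hU : IsAffineOpen U) (V : (Spec Γ(X, U)).Opens) :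
    hU.fromSpec ''ᵁ V ≤ U := by
  rintro _ ⟨y, -, rfl⟩
  rw [← SetLike.mem_coe, ← hU.range_fromSpec]
  exact Set.mem_range_self y

lemma fromSpec_appIso_inv {U : X.Opens} (hU : IsAffineOpen U) (V : (Spec Γ(X, U)).Opens)
    (r : Γ(X, U)) :
    (hU.fromSpec.appIso V).inv
      ((Spec Γ(X, U)).presheaf.map V.leTop.op ((Scheme.ΓSpecIso Γ(X, U)).inv r)) =
      X.presheaf.map (homOfLE (image_fromSpec_le hU V)).op r := by
  have h : (Scheme.ΓSpecIso Γ(X, U)).inv ≫ (Spec Γ(X, U)).presheaf.map V.leTop.op =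
      X.presheaf.map (homOfLE (image_fromSpec_le hU V)).op ≫ (hU.fromSpec.appIso V).hom := by
    rw [Scheme.Hom.appIso_hom', Scheme.Hom.map_appLE, Scheme.Hom.appLE, hU.fromSpec_app_self,
      Category.assoc, ← Functor.map_comp]
    rfl
  have h' := congrArg (fun φ => (φ ≫ (hU.fromSpec.appIso V).inv) r) h
  simpa only [Category.assoc, Iso.hom_inv_id, Category.comp_id, CommRingCat.comp_apply] using h'

lemma smul_restrict_fromSpec (E : X.Modules) {U : X.Opens} (hU : IsAffineOpen U)
    (V : (Spec Γ(X, U)).Opens) (r : Γ(X, U)) (y : Γ(E.restrict hU.fromSpec, V)) :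
    (E.restrictAppIso hU.fromSpec V).hom (r • y) =
      X.presheaf.map (homOfLE (image_fromSpec_le hU V)).op r •
        (E.restrictAppIso hU.fromSpec V).hom y := by
  rw [Scheme.Modules.smul_Spec_def, ← fromSpec_appIso_inv]
  exact Scheme.Modules.smul_restrictAppIso_hom_apply _ E V _ y

/-- Elements of the stalk of a quasi-coherent sheaf are fractions of sections over an affine
neighbourhood. -/
lemma exists_smul_eq_germ (E : X.Modules) [E.IsQuasicoherent] {U : X.Opens} (hU : IsAffineOpen U)
    {x : X} (hx : x ∈ U) (m : stalk E x) : ∃ (a : Γ(X, U)) (s : Γ(E, U)),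
      IsUnit (X.presheaf.germ U x hx a) ∧
        X.presheaf.germ U x hx a • m = E.presheaf.germ U x hx s := by
  obtain ⟨W, hWU, hxW, s, rfl⟩ := exists_germ_eq E hx m
  obtain ⟨f, hfW, hxf⟩ := hU.exists_basicOpen_le ⟨x, hxW⟩ hx
  have hloc := (isIso_fromTildeΓ_iff_isLocalizing (E.restrict hU.fromSpec)).mp inferInstance f
  let D : (Spec Γ(X, U)).Opens := PrimeSpectrum.basicOpen f
  have himg : hU.fromSpec ''ᵁ D = X.basicOpen f :=
    hU.fromSpec_image_basicOpen f
  have hle : hU.fromSpec ''ᵁ D ≤ W := himg.le.trans hfW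
  have hxD : x ∈ hU.fromSpec ''ᵁ D := himg.ge hxf
  have hUT : U ≤ hU.fromSpec ''ᵁ ⊤ := by
    rw [Scheme.Hom.image_top_eq_opensRange, hU.opensRange_fromSpec]
  -- Transported to `Spec Γ(X, U)`, sections over `D(f)` are the localization of the global ones, so
  -- a power of `f` clears the denominator; `f` is a unit at `x`.
  obtain ⟨⟨t, ⟨_, n, rfl⟩⟩, ht⟩ := hloc.surj
    ((E.restrictAppIso hU.fromSpec D).inv
      (E.presheaf.map (homOfLE hle).op s))
  refine ⟨f ^ n, E.presheaf.map (homOfLE hUT).op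
    ((E.restrictAppIso hU.fromSpec ⊤).hom t), ?_, ?_⟩
  · rw [map_pow]
    exact ((X.mem_basicOpen f x hx).mp hxf).pow n
  · have h1 : (E.restrictAppIso hU.fromSpec D).hom
        (f ^ n • (E.restrictAppIso hU.fromSpec D).inv
          (E.presheaf.map (homOfLE hle).op s)) =
      E.presheaf.map (homOfLE (Scheme.Hom.image_mono hU.fromSpec le_top)).op
        ((E.restrictAppIso hU.fromSpec ⊤).hom t) := congrArg _ ht
    rw [smul_restrict_fromSpec] at h1
    have h2 := congrArg (E.presheaf.germ _ x hxD) h1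
    rw [germ_smul, germ_res_apply', module_germ_res, Iso.inv_hom_id_apply, module_germ_res] at h2
    rw [module_germ_res, ← h2]

end Quasicoherent

/-! ### Reflexive sheaves: torsion-freeness and extension from codimension one. -/

section Reflexive

variable {X : Scheme.{u}}

lemma evalSection_bijective (M : X.PresheafOfModules) [IsIso (toDoubleDual M)] (U : X.Opens) :
    Function.Bijective (evalSection M U) := by
  have : IsIso ((PresheafOfModules.evaluation _ (op U)).map (toDoubleDual M)) := inferInstance
  exact ConcreteCategory.bijective_of_isIso
    ((PresheafOfModules.evaluation _ (op U)).map (toDoubleDual M))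

lemma germ_dualSection_app {E : X.Modules} {V V₁ V₂ : X.Opens} (φ : DualSection E.val V)
    (h₁ : V₁ ≤ V) (h₂ : V₂ ≤ V) {x : X} (hx₁ : x ∈ V₁) (hx₂ : x ∈ V₂) (s : Γ(E, V₁)) (t : Γ(E, V₂))
    (h : E.presheaf.germ V₁ x hx₁ s = E.presheaf.germ V₂ x hx₂ t) :
    X.presheaf.germ V₁ x hx₁ (φ.app V₁ h₁ s) = X.presheaf.germ V₂ x hx₂ (φ.app V₂ h₂ t) := by
  obtain ⟨W, hxW, i₁, i₂, hW⟩ := E.presheaf.germ_eq x hx₁ hx₂ s t h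
  have hW' : resₛₗ E.val i₁.le s = resₛₗ E.val i₂.le t := hW
  rw [← germ_res_apply' i₁.le hxW, ← germ_res_apply' i₂.le hxW]
  exact congrArg _ ((φ.naturality V₁ W h₁ i₁.le s).symm.trans
    ((congrArg (φ.app W (i₁.le.trans h₁)) hW').trans (φ.naturality V₂ W h₂ i₂.le t)))

variable [IsIntegral X]

/-- A section is determined by its values under all local functionals. These values are regular
functions, hence determined at the generic point. -/
lemma germ_injective_of_isIso_toDoubleDual (E : X.Modules) [IsIso (toDoubleDual E.val)]
    {U : X.Opens} {s t : Γ(E, U)} (h : ∀ hη : genericPoint X ∈ U,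
      E.presheaf.germ U (genericPoint X) hη s = E.presheaf.germ U (genericPoint X) hη t) :
    s = t := by
  refine (evalSection_bijective E.val U).1 (DualSection.ext (funext fun V => funext fun hV =>
    LinearMap.ext fun (φ : DualSection E.val V) => eq_of_germ_eq fun hη => ?_))
  refine germ_dualSection_app φ le_rfl le_rfl hη hη _ _ ?_
  exact (module_germ_res E hV hη s).trans ((h (hV hη)).trans (module_germ_res E hV hη t).symm)

lemma toGenericStalk_injective (E : X.Modules) [IsIso (toDoubleDual E.val)] (x : X) :
    Function.Injective (toGenericStalk E x) := by
  rw [injective_iff_map_eq_zero]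
  intro m hm
  obtain ⟨V, -, hxV, s, rfl⟩ := exists_germ_eq E (U := ⊤) trivial m
  rw [toGenericStalk_germ E hxV (genericPoint_mem hxV)] at hm
  have : s = 0 := germ_injective_of_isIso_toDoubleDual E fun hη => by rw [hm, map_zero]
  rw [this, map_zero]

/-- Sections of a reflexive sheaf on a normal scheme are determined in codimension one. -/
lemma exists_section_of_forall_primeDivisor [IsLocallyNoetherian X]
    [∀ x : X, IsIntegrallyClosed (X.presheaf.stalk x)] (E : X.Modules)
    [IsIso (toDoubleDual E.val)] {U : X.Opens} (hη : genericPoint X ∈ U) (e : genericStalk E)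
    (h : ∀ P : PrimeDivisor X, P.1 ∈ U → IsRegularAt E P.1 e) :
    ∃ s : Γ(E, U), E.presheaf.germ U (genericPoint X) hη s = e := by
  obtain ⟨W, hWU, hηW, t, rfl⟩ := exists_germ_eq E hη e
  -- The value of `φ` on the rational section `e`: it is regular at each prime divisor of `V`,
  -- because `e` comes from a section there, so it is a regular function on `V`.
  have key (V : X.Opens) (hV : V ≤ U) (φ : DualSection E.val V) : ∃ r : Γ(X, V),
      ∀ (V' : X.Opens) (hV' : V' ≤ V) (hη' : genericPoint X ∈ V') (s : Γ(E, V')),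
        E.presheaf.germ V' _ hη' s = E.presheaf.germ W _ hηW t →
        X.presheaf.germ V _ (hV' hη') r = X.presheaf.germ V' _ hη' (φ.app V' hV' s) := by
    by_cases hηV : genericPoint X ∈ V
    swap
    · exact ⟨0, fun V' hV' hη' => (hηV (hV' hη')).elim⟩
    have hη₀ : genericPoint X ∈ V ⊓ W := ⟨hηV, hηW⟩
    have ht := module_germ_res E (inf_le_right : V ⊓ W ≤ W) hη₀ t
    obtain ⟨r, hr⟩ := exists_germ_eq_of_forall_primeDivisor hηV
      (X.presheaf.germ (V ⊓ W) _ hη₀ (φ.app (V ⊓ W) inf_le_left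
        (E.presheaf.map (homOfLE inf_le_right).op t))) fun P hP => by
      obtain ⟨V₁, hV₁, hPV₁, s₁, hs₁⟩ := (h P (hV hP)).exists_germ_eq hP
      refine ⟨X.presheaf.germ V₁ P.1 hPV₁ (φ.app V₁ hV₁ s₁), ?_⟩
      rw [algebraMap_germ hPV₁ (genericPoint_mem hPV₁)]
      exact germ_dualSection_app φ _ _ _ _ _ _ (hs₁.trans ht.symm)
    exact ⟨r, fun V' hV' hη' s hs => hr.trans
      (germ_dualSection_app φ _ _ _ _ _ _ (ht.trans hs.symm))⟩
  choose r hr using key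
  have hr' (V : X.Opens) (hV : V ≤ U) (φ : DualSection E.val V) (hηV : genericPoint X ∈ V) :
      X.presheaf.germ V _ hηV (r V hV φ) = X.presheaf.germ (V ⊓ W) _ ⟨hηV, hηW⟩
        (φ.app (V ⊓ W) inf_le_left (E.presheaf.map (homOfLE inf_le_right).op t)) :=
    hr V hV φ (V ⊓ W) inf_le_left ⟨hηV, hηW⟩ _ (module_germ_res E inf_le_right _ t)
  -- Evaluation at `e` is a section of the double dual over all of `U`, so it comes from a section
  -- of `E`.
  let ε : DualSection (dual E.val) U :=
    { app := fun V hV =>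
        { toFun := fun φ : DualSection E.val V => r V hV φ
          map_add' := fun φ ψ : DualSection E.val V => eq_of_germ_eq fun hηV => by
            rw [map_add, hr', hr', ← map_add]
            exact hr' V hV (φ + ψ) hηV
          map_smul' := fun a (φ : DualSection E.val V) => eq_of_germ_eq fun hηV => by
            rw [RingHom.id_apply, smul_eq_mul, map_mul, hr',
              ← germ_res_apply' (inf_le_left : V ⊓ W ≤ V) ⟨hηV, hηW⟩ a, ← map_mul]
            exact hr' V hV (a • φ) hηV }
      naturality := fun V V' hV hV' (φ : DualSection E.val V) => eq_of_germ_eq fun hηV' => by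
        rw [germ_res_apply' hV']
        refine (hr' V' (hV'.trans hV) (DualSection.res hV' φ) hηV').trans ?_
        exact (hr V hV φ (V' ⊓ W) (inf_le_left.trans hV') ⟨hηV', hηW⟩ _
          (module_germ_res E inf_le_right _ t)).symm }
  obtain ⟨s, hs⟩ := (evalSection_bijective E.val U).2 ε
  refine ⟨s, ?_⟩
  suffices hW : E.presheaf.map (homOfLE hWU).op s = t by
    rw [← hW]
    exact (module_germ_res E hWU hηW s).symm
  refine (evalSection_bijective E.val W).1 (DualSection.ext (funext fun V => funext fun hV =>
    LinearMap.ext fun (φ : DualSection E.val V) => ?_))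
  have h1 : φ.app V le_rfl (resₛₗ E.val (hV.trans hWU) s) = r V (hV.trans hWU) φ :=
    LinearMap.congr_fun (congrFun (congrFun (congrArg DualSection.app hs) V) (hV.trans hWU)) φ
  refine Eq.trans (congrArg (φ.app V le_rfl) (resₛₗ_resₛₗ E.val hWU hV s)) (h1.trans ?_)
  refine eq_of_germ_eq fun hηV => ?_
  exact hr V (hV.trans hWU) φ V le_rfl hηV _ (module_germ_res E hV hηV t)

end Reflexive

/-! ### Existence, uniqueness and local meaning of the divisor of an element. -/

section Divisors

variable {X : Scheme.{u}} [IsIntegral X] [IsLocallyNoetherian X]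

/-- Over an affine open, the multipliers of a nonzero element of the generic stalk of a coherent
sheaf into its stalks are bounded from both sides. -/
lemma IsCoherent.exists_bounds {E : X.Modules} (hE : IsCoherent E) {U : X.Opens}
    (hU : IsAffineOpen U) (hη : genericPoint X ∈ U) {e : genericStalk E} (he : e ≠ 0) :
    ∃ a g : X.functionField, a ≠ 0 ∧ g ≠ 0 ∧ ∀ x ∈ U, IsRegularAt E x (a • e) ∧
      ∀ f : X.functionField, IsRegularAt E x (f • e) →
        ∃ b : X.presheaf.stalk x, algebraMap (X.presheaf.stalk x) X.functionField b = g * f := by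
  have := hE.isQuasicoherent
  have : Module.Finite Γ(X, U) Γ(E, U) := hE.finite U hU
  have : IsNoetherianRing Γ(X, U) := IsLocallyNoetherian.component_noetherian ⟨U, hU⟩
  have : Nonempty U := ⟨⟨_, hη⟩⟩
  have := functionField_isFractionRing_of_isAffineOpen X U hU
  obtain ⟨a, m, ha, hm⟩ := exists_smul_eq_germ E hU hη e
  let : Module Γ(X, U) (genericStalk E) :=
    Module.compHom (genericStalk E) (X.presheaf.germ U (genericPoint X) hη).hom
  have smul_def (r : Γ(X, U)) (e' : genericStalk E) :
      r • e' = X.presheaf.germ U (genericPoint X) hη r • e' := rfl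
  let ρ : Γ(E, U) →ₗ[Γ(X, U)] genericStalk E :=
    { toFun := E.presheaf.germ U (genericPoint X) hη
      map_add' := map_add _
      map_smul' := germ_smul E _ U hη }
  let σ : X.functionField →ₗ[Γ(X, U)] genericStalk E :=
    { toFun := fun f => f • e
      map_add' := fun f f' => add_smul f f' e
      map_smul' := fun r f => mul_smul (X.presheaf.germ U (genericPoint X) hη r) f e }
  have hσ : Function.Injective σ := by
    rw [injective_iff_map_eq_zero]
    intro f hf
    by_contra h
    exact smul_ne_zero_genericStalk h he hf
  -- `J` consists of the `f` with `f • e` in the image of `E(U)`. Since `e ≠ 0` it embeds into a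
  -- Noetherian module, so it is finitely generated and has a common denominator `g`.
  let J : Submodule Γ(X, U) X.functionField := (LinearMap.range ρ).comap σ
  have hJ : J.FG := by
    have : IsNoetherian Γ(X, U) J :=
      isNoetherian_of_injective (σ.restrict (p := J) (q := LinearMap.range ρ) fun _ h => h)
        fun x y hxy => Subtype.ext (hσ (congrArg Subtype.val hxy))
    exact Module.Finite.iff_fg.mp inferInstance
  obtain ⟨g, hg, hgJ⟩ := FractionalIdeal.isFractional_of_fg (S := nonZeroDivisors Γ(X, U)) hJ
  refine ⟨X.presheaf.germ U _ hη a, X.presheaf.germ U _ hη g, ha.ne_zero, ?_, fun x hx =>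
    ⟨hm ▸ isRegularAt_germ E hx hη m, fun f ⟨m', hm'⟩ => ?_⟩⟩
  · exact fun h0 => nonZeroDivisors.ne_zero hg
      (germ_injective_of_isIntegral X _ hη (h0.trans (map_zero _).symm))
  · obtain ⟨s, t, hs, hst⟩ := exists_smul_eq_germ E hU hx m'
    -- A multiplier at `x` lands in `J` after multiplication by some `s` that is a unit at `x`, so
    -- `g` serves all stalks over `U` at once.
    have hs' : X.presheaf.germ U _ hη s * f ∈ J := by
      refine ⟨t, ?_⟩
      change E.presheaf.germ U _ hη t = (X.presheaf.germ U _ hη s * f) • e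
      rw [mul_smul, ← hm', ← algebraMap_germ hx hη, ← toGenericStalk_smul, hst,
        toGenericStalk_germ E hx hη]
    obtain ⟨c, hc⟩ := hgJ _ hs'
    obtain ⟨u, hu⟩ := hs
    have hc' : X.presheaf.germ U _ hη c =
        X.presheaf.germ U _ hη g * (X.presheaf.germ U _ hη s * f) := hc
    refine ⟨↑u⁻¹ * X.presheaf.germ U x hx c, ?_⟩
    have hs0 : algebraMap (X.presheaf.stalk x) X.functionField ↑u ≠ 0 := by simp
    rw [map_mul, algebraMap_germ hx hη, hc', ← algebraMap_germ hx hη s, ← hu, map_units_inv]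
    field_simp

lemma exists_open_mem_divisorSections [CompactSpace X] (D : WeilDivisor X) (P : PrimeDivisor X)
    {f : X.functionField} (hf : f ≠ 0) (h : 0 ≤ D P + Scheme.ord f P.1) :
    ∃ U : X.Opens, P.1 ∈ U ∧ f ∈ divisorSections D U := by
  have hB : {Q : PrimeDivisor X | D Q + Scheme.ord f Q.1 < 0}.Finite := by
    refine (D.hasFiniteSupport.union (finite_ord_ne_zero hf)).subset fun Q hQ => ?_
    by_contra hcon
    simp only [Set.mem_union, Set.mem_ofPred_eq, not_or, not_not, Function.mem_support] at hcon hQ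
    lia
  obtain ⟨U, hPU, hU⟩ := exists_open_of_finite hB (P := P) (not_lt.mpr h)
  exact ⟨U, hPU, Or.inr fun Q hQ => not_lt.mp fun hlt => hU Q hlt hQ⟩

lemma weilDecoration_zero (E : X.Modules) : weilDecoration E 0 = ⊤ := if_pos rfl

variable [∀ x : X, IsIntegrallyClosed (X.presheaf.stalk x)]

/-- The multipliers form a fractional ideal of a discrete valuation ring, determined by its least
order, and `n` is minus that order. The two bounds on `n` are what later makes the support of the
divisor finite. -/
lemma exists_coeff_of_bounds {E : X.Modules} (P : PrimeDivisor X) {e : genericStalk E}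
    {a g : X.functionField} (ha : a ≠ 0) (hg : g ≠ 0) (hae : IsRegularAt E P.1 (a • e))
    (hge : ∀ f : X.functionField, IsRegularAt E P.1 (f • e) →
        ∃ b : X.presheaf.stalk P.1, algebraMap (X.presheaf.stalk P.1) X.functionField b = g * f) :
    ∃ n : ℤ, (∀ f : X.functionField, f ≠ 0 →
      (IsRegularAt E P.1 (f • e) ↔ 0 ≤ n + Scheme.ord f P.1)) ∧
      - Scheme.ord a P.1 ≤ n ∧ n ≤ Scheme.ord g P.1 := by
  have hlow (f : X.functionField) (hf : f ≠ 0) (h : IsRegularAt E P.1 (f • e)) :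
      - Scheme.ord g P.1 ≤ Scheme.ord f P.1 := by
    have := (zero_le_ord_iff P (mul_ne_zero hg hf)).mpr (hge f h)
    rw [Scheme.ord_mul hg hf] at this
    lia
  obtain ⟨m, ⟨f₀, hf₀, hf₀e, rfl⟩, hmin⟩ := Int.exists_least_of_bdd
    (P := fun m => ∃ f : X.functionField, f ≠ 0 ∧ IsRegularAt E P.1 (f • e) ∧
      Scheme.ord f P.1 = m)
    ⟨- Scheme.ord g P.1, fun z ⟨f, hf, hfe, hz⟩ => hz ▸ hlow f hf hfe⟩ ⟨_, a, ha, hae, rfl⟩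
  refine ⟨- Scheme.ord f₀ P.1, fun f hf => ⟨fun h => ?_, fun h => ?_⟩, ?_, ?_⟩
  · have := hmin _ ⟨f, hf, h, rfl⟩
    lia
  · have h' : 0 ≤ Scheme.ord (f * f₀⁻¹) P.1 := by
      rw [Scheme.ord_mul hf (inv_ne_zero hf₀), ord_inv P hf₀]
      lia
    obtain ⟨b, hb⟩ := (zero_le_ord_iff P (mul_ne_zero hf (inv_ne_zero hf₀))).mp h'
    have := hf₀e.smul b
    rwa [hb, ← mul_smul, mul_assoc, inv_mul_cancel₀ hf₀, mul_one] at this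
  · have := hmin _ ⟨a, ha, hae, rfl⟩
    lia
  · have := hlow f₀ hf₀ hf₀e
    lia

/-- Functions of order exactly `- D P` and `- D' P` detect the two inequalities. -/
lemma eq_of_forall_ord {D D' : WeilDivisor X} (h : ∀ (P : PrimeDivisor X) (f : X.functionField),
    f ≠ 0 → (0 ≤ D P + Scheme.ord f P.1 ↔ 0 ≤ D' P + Scheme.ord f P.1)) : D = D' := by
  ext P
  obtain ⟨f, hf, hfP⟩ := exists_ord_eq P (- D P)
  obtain ⟨f', hf', hfP'⟩ := exists_ord_eq P (- D' P)
  have h1 := (h P f hf).mp (by lia)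
  have h2 := (h P f' hf').mpr (by lia)
  lia

variable [CompactSpace X]

lemma IsCoherent.exists_weilDivisor {E : X.Modules} (hE : IsCoherent E) {e : genericStalk E}
    (he : e ≠ 0) : ∃ D : WeilDivisor X, ∀ (P : PrimeDivisor X) (f : X.functionField), f ≠ 0 →
      (IsRegularAt E P.1 (f • e) ↔ 0 ≤ D P + Scheme.ord f P.1) := by
  obtain ⟨S, hS, hcov⟩ := exists_isAffineOpen_cover (X := X)
  have hbd (U : X.affineOpens) : ∃ a g : X.functionField, a ≠ 0 ∧ g ≠ 0 ∧
      ∀ x ∈ U.1, IsRegularAt E x (a • e) ∧ ∀ f : X.functionField, IsRegularAt E x (f • e) →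
        ∃ b : X.presheaf.stalk x, algebraMap (X.presheaf.stalk x) X.functionField b = g * f := by
    by_cases hη : genericPoint X ∈ U.1
    · exact hE.exists_bounds U.2 hη he
    · exact ⟨1, 1, one_ne_zero, one_ne_zero, fun x hx => (hη (genericPoint_mem hx)).elim⟩
  choose a g ha hg hbd using hbd
  have hn (P : PrimeDivisor X) : ∃ n : ℤ, (∀ f : X.functionField, f ≠ 0 →
      (IsRegularAt E P.1 (f • e) ↔ 0 ≤ n + Scheme.ord f P.1)) ∧
      ∃ U ∈ S, - Scheme.ord (a U) P.1 ≤ n ∧ n ≤ Scheme.ord (g U) P.1 := by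
    obtain ⟨U, hU, hPU⟩ := hcov P.1
    obtain ⟨n, h, h'⟩ := exists_coeff_of_bounds P (ha U) (hg U) (hbd U P.1 hPU).1 (hbd U P.1 hPU).2
    exact ⟨n, h, U, hU, h'⟩
  choose n hn hn' using hn
  -- A nonzero coefficient lies between `- ord a` and `ord g` for one of finitely many charts, so
  -- `a` or `g` has nonzero order at `P`.
  have hfin : {P | n P ≠ 0}.Finite := by
    refine (hS.biUnion fun U _ => (finite_ord_ne_zero (ha U)).union
      (finite_ord_ne_zero (hg U))).subset fun P hP => ?_
    obtain ⟨U, hU, h1, h2⟩ := hn' P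
    refine Set.mem_biUnion hU ?_
    by_contra hcon
    simp only [Set.mem_union, Set.mem_ofPred_eq, not_or, not_not] at hcon
    exact hP (by lia)
  exact ⟨Finsupp.ofSupportFinite n hfin, hn⟩

/-- From sheaves to stalks, one shrinks around `P` to avoid the finitely many divisors where `D +
div(f)` is negative. From stalks to sheaves, reflexivity extends `f • e` over `U` from codimension
one. -/
lemma IsReflexive.isDivisorOf_iff {E : X.Modules} (hE : IsReflexive E) {e : genericStalk E}
    {D : WeilDivisor X} : IsDivisorOf E e D ↔
      ∀ (P : PrimeDivisor X) (f : X.functionField), f ≠ 0 →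
        (IsRegularAt E P.1 (f • e) ↔ 0 ≤ D P + Scheme.ord f P.1) := by
  have := hE.isIso_toDoubleDual
  refine ⟨fun h P f hf => ⟨fun hfe => ?_, fun hfP => ?_⟩, fun h U hη => Set.ext fun f => ?_⟩
  · obtain ⟨V, -, hPV, s, hs⟩ := hfe.exists_germ_eq (U := ⊤) trivial
    have hmem : f ∈ divisorSections D V := (h V (genericPoint_mem hPV)).symm ▸ ⟨s, hs⟩
    exact (hmem.resolve_left hf) P hPV
  · obtain ⟨U, hPU, hfU⟩ := exists_open_mem_divisorSections D P hf hfP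
    rw [h U (genericPoint_mem hPU)] at hfU
    obtain ⟨s, hs⟩ := hfU
    exact hs ▸ isRegularAt_germ E hPU _ s
  · by_cases hf : f = 0
    · subst hf
      exact ⟨fun _ => ⟨0, by rw [map_zero, zero_smul]⟩, fun _ => Or.inl rfl⟩
    refine ⟨fun hfU => ?_, fun ⟨s, hs⟩ => Or.inr fun P hP => ?_⟩
    · exact exists_section_of_forall_primeDivisor E hη (f • e) fun P hP =>
        (h P f hf).mpr (hfU.resolve_left hf P hP)
    · exact (h P f hf).mp (hs ▸ isRegularAt_germ E hP _ s)

lemma IsReflexive.existsUnique_isDivisorOf {E : X.Modules} (hE : IsReflexive E)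
    {e : genericStalk E} (he : e ≠ 0) : ∃! D : WeilDivisor X, IsDivisorOf E e D := by
  obtain ⟨D, hD⟩ := hE.isCoherent.exists_weilDivisor he
  refine ⟨D, hE.isDivisorOf_iff.mpr hD, fun D' hD' => eq_of_forall_ord fun P f hf => ?_⟩
  exact (hE.isDivisorOf_iff.mp hD' P f hf).symm.trans (hD P f hf)

lemma IsReflexive.weilDecoration_eq {E : X.Modules} (hE : IsReflexive E) {e : genericStalk E}
    (he : e ≠ 0) : ∃ D : WeilDivisor X, weilDecoration E e = D ∧ IsDivisorOf E e D := by
  have h := (hE.existsUnique_isDivisorOf he).exists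
  exact ⟨h.choose, by rw [weilDecoration, if_neg he, dif_pos h], h.choose_spec⟩

/-- The Weil decoration at `P` tells which multiples of an element extend to `P`. -/
lemma IsReflexive.isRegularAt_smul_iff {E : X.Modules} (hE : IsReflexive E) (P : PrimeDivisor X)
    (e : genericStalk E) {f : X.functionField} (hf : f ≠ 0) :
    IsRegularAt E P.1 (f • e) ↔
      ((- Scheme.ord f P.1 : ℤ) : WithTop ℤ) ≤ coeff P (weilDecoration E e) := by
  by_cases he : e = 0
  · subst he
    rw [smul_zero, weilDecoration_zero]
    exact ⟨fun _ => le_top, fun _ => isRegularAt_zero E P.1⟩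
  · obtain ⟨D, hD, hdiv⟩ := hE.weilDecoration_eq he
    rw [hE.isDivisorOf_iff.mp hdiv P f hf, hD]
    change _ ↔ ((- Scheme.ord f P.1 : ℤ) : WithTop ℤ) ≤ ((D P : ℤ) : WithTop ℤ)
    rw [WithTop.coe_le_coe]
    lia

/-- Functions of every integral order exist, so the multipliers recover the coefficient, including
the value `∞`. All later comparisons go through this criterion. -/
lemma coeff_weilDecoration_le_iff {E E' : X.Modules} (hE : IsReflexive E) (hE' : IsReflexive E')
    (P : PrimeDivisor X) (e : genericStalk E) (e' : genericStalk E') :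
    coeff P (weilDecoration E e) ≤ coeff P (weilDecoration E' e') ↔
      ∀ f : X.functionField, IsRegularAt E P.1 (f • e) → IsRegularAt E' P.1 (f • e') := by
  refine ⟨fun h f hfe => ?_, fun h => ?_⟩
  · by_cases hf : f = 0
    · subst hf
      rw [zero_smul]
      exact isRegularAt_zero E' P.1
    · rw [hE'.isRegularAt_smul_iff P e' hf]
      exact ((hE.isRegularAt_smul_iff P e hf).mp hfe).trans h
  · refine WithTop.forall_coe_le_iff_le.mp fun n hn => ?_
    obtain ⟨f, hf, hfP⟩ := exists_ord_eq P (-n)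
    have := h f ((hE.isRegularAt_smul_iff P e hf).mpr (by rwa [hfP, neg_neg]))
    rwa [hE'.isRegularAt_smul_iff P e' hf, hfP, neg_neg] at this

end Divisors

/-! ### Exactness of kernels and epimorphisms on sections and stalks. -/

section Exactness

variable {X : Scheme.{u}}

variable (X) in
/-- Sections over `U`, as a functor to abelian groups. -/
noncomputable abbrev sectionsFunctor (U : X.Opens) : X.Modules ⥤ Ab.{u} :=
  Scheme.Modules.toPresheaf X ⋙ (evaluation X.Opensᵒᵖ Ab.{u}).obj (op U)

instance (U : X.Opens) : Limits.PreservesFiniteLimits (sectionsFunctor X U) :=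
  have : Limits.PreservesLimits ((evaluation X.Opensᵒᵖ Ab.{u}).obj (op U)) :=
    Limits.evaluationPreservesLimits _
  have : Limits.PreservesLimits (sectionsFunctor X U) := Limits.comp_preservesLimits _ _
  Limits.PreservesLimits.preservesFiniteLimits _

instance (U : X.Opens) : (sectionsFunctor X U).Additive where

lemma app_injective {E' E : X.Modules} (ι : E' ⟶ E) [Mono ι] (U : X.Opens) :
    Function.Injective (ι.app U) := by
  exact (AddCommGrpCat.mono_iff_injective ((sectionsFunctor X U).map ι)).mp inferInstance

lemma stalkMap_injective {E' E : X.Modules} (ι : E' ⟶ E) [Mono ι] (x : X) :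
    Function.Injective (stalkMap ι x) :=
  TopCat.Presheaf.stalkFunctor_map_injective_of_app_injective
    (fun U => app_injective ι U) x

/-- On sections, a kernel of a morphism of sheaves of modules is exact. -/
lemma exists_app_eq_of_isLimit {E' E E'' : X.Modules} (ι : E' ⟶ E) (φ : E ⟶ E'') (w : ι ≫ φ = 0)
    (h : Limits.IsLimit (Limits.KernelFork.ofι ι w)) {U : X.Opens} {s : Γ(E, U)}
    (hs : φ.app U s = 0) : ∃ t : Γ(E', U), ι.app U t = s := by
  have : Mono ι := Limits.mono_of_isLimit_fork h
  let S := ShortComplex.mk ι φ w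
  have hS : S.Exact := S.exact_of_f_is_kernel h
  have hFS := hS.map_of_mono_of_preservesKernel (sectionsFunctor X U) this inferInstance
  exact (ShortComplex.ab_exact_iff _).mp hFS s hs

lemma exists_stalkMap_eq_of_isLimit {E' E E'' : X.Modules} (ι : E' ⟶ E) (φ : E ⟶ E'')
    (w : ι ≫ φ = 0) (h : Limits.IsLimit (Limits.KernelFork.ofι ι w)) {x : X} {m : stalk E x}
    (hm : stalkMap φ x m = 0) : ∃ m' : stalk E' x, stalkMap ι x m' = m := by
  obtain ⟨U, -, hxU, s, rfl⟩ := exists_germ_eq E (U := ⊤) trivial m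
  rw [stalkMap_germ, ← map_zero (E''.presheaf.germ U x hxU).hom] at hm
  obtain ⟨V, hxV, i, i', hV⟩ := E''.presheaf.germ_eq x hxU hxU _ _ hm
  rw [map_zero] at hV
  have hnat : φ.app V (E.presheaf.map i.op s) = E''.presheaf.map i.op (φ.app U s) :=
    NatTrans.naturality_apply φ.mapPresheaf i.op s
  obtain ⟨t, ht⟩ := exists_app_eq_of_isLimit ι φ w h (hnat.trans hV)
  refine ⟨E'.presheaf.germ V x hxV t, ?_⟩
  rw [stalkMap_germ, ht]
  exact E.presheaf.germ_res_apply i x hxV s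

lemma stalkMap_stalkMap_eq_zero {E' E E'' : X.Modules} {ι : E' ⟶ E} {φ : E ⟶ E''}
    (w : ι ≫ φ = 0) {x : X} (m : stalk E' x) : stalkMap φ x (stalkMap ι x m) = 0 := by
  obtain ⟨U, -, hxU, s, rfl⟩ := exists_germ_eq E' (U := ⊤) trivial m
  have h : φ.app U (ι.app U s) = 0 := congrArg (fun ψ : E' ⟶ E'' => ψ.app U s) w
  rw [stalkMap_germ, stalkMap_germ, h, map_zero]

/-- Epimorphisms of sheaves of modules are surjective on stalks. -/
lemma stalkMap_surjective {E E' : X.Modules} (μ : E ⟶ E') [Epi μ] (x : X) :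
    Function.Surjective (stalkMap μ x) := by
  let R := X.ringCatSheaf
  let f : E.val ⟶ E'.val := (Scheme.Modules.toPresheafOfModules X).map μ
  let C := Limits.cokernel f
  let η := (PresheafOfModules.sheafificationAdjunction (𝟙 R.obj)).unit.app C
  let G : X.Modules := (PresheafOfModules.sheafification (𝟙 R.obj)).obj C
  let q : E'.val ⟶ G.val := Limits.cokernel.π f ≫ η
  let q' : E' ⟶ G := (⟨q⟩ : SheafOfModules.Hom E' G)
  -- The map to the sheafified presheaf cokernel kills `μ`, hence vanishes because `μ` is an
  -- epimorphism. So every class in the presheaf cokernel is locally zero.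
  have hq' : q' = 0 := by
    rw [← cancel_epi μ, Limits.comp_zero]
    apply (Scheme.Modules.toPresheafOfModules X).map_injective
    exact (Limits.cokernel.condition_assoc f η).trans Limits.zero_comp
  have hq (U : X.Opens) (s : Γ(E', U)) : q.app (op U) s = 0 :=
    congrArg (fun ψ : E' ⟶ G => ψ.app U s) hq'
  intro m
  obtain ⟨U, -, hxU, s, rfl⟩ := exists_germ_eq E' (U := ⊤) trivial m
  let c : C.presheaf.obj (op U) := (Limits.cokernel.π f).app (op U) s
  let τ := CategoryTheory.toSheafify (Opens.grothendieckTopology X) C.presheaf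
  have hc : τ.app (op U) c = τ.app (op U) 0 := (hq U s).trans (map_zero _).symm
  have := Presheaf.equalizerSieve_mem (Opens.grothendieckTopology X) τ c 0 hc
  obtain ⟨V, i, hi, hxV⟩ := this x hxU
  have hV : (Limits.cokernel.π f).app (op V) (E'.presheaf.map i.op s) = 0 :=
    (PresheafOfModules.naturality_apply (Limits.cokernel.π f) i.op s).trans
      (hi.trans (map_zero _))
  let S := ShortComplex.mk f (Limits.cokernel.π f) (Limits.cokernel.condition f)
  have hS : S.Exact := ShortComplex.exact_cokernel f
  have hFS := hS.map_of_epi_of_preservesCokernel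
    (PresheafOfModules.evaluation X.ringCatSheaf.obj (op V)) inferInstance inferInstance
  obtain ⟨t, ht⟩ : ∃ t : Γ(E, V), μ.app V t = E'.presheaf.map i.op s :=
    (ShortComplex.moduleCat_exact_iff _).mp hFS (E'.presheaf.map i.op s) hV
  refine ⟨E.presheaf.germ V x hxV t, ?_⟩
  rw [stalkMap_germ, ht]
  exact E'.presheaf.germ_res_apply i x hxV s

end Exactness

/-! ### Clearing denominators at a point. -/

section Denominators

variable {X : Scheme.{u}} [IsIntegral X]

lemma exists_smul_isRegularAt {E : X.Modules} (hE : IsCoherent E) (x : X) (e : genericStalk E) :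
    ∃ r : X.presheaf.stalk x, r ≠ 0 ∧
      IsRegularAt E x (algebraMap (X.presheaf.stalk x) X.functionField r • e) := by
  have := hE.isQuasicoherent
  obtain ⟨U, hU, hx, -⟩ := exists_isAffineOpen_mem_le (U := ⊤) (x := x) trivial
  have hη := genericPoint_mem hx
  obtain ⟨a, m, ha, hm⟩ := exists_smul_eq_germ E hU hη e
  refine ⟨X.presheaf.germ U x hx a, fun h0 => ?_, ?_⟩
  · apply ha.ne_zero
    rw [← algebraMap_germ hx hη, h0, map_zero]
  · rw [algebraMap_germ hx hη, hm]
    exact isRegularAt_germ E hx hη m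

end Denominators

/-! ### Comparison of decorations along morphisms. -/

section Comparison

variable {X : Scheme.{u}} [IsIntegral X] [IsLocallyNoetherian X]
  [∀ x : X, IsIntegrallyClosed (X.presheaf.stalk x)] [CompactSpace X]

lemma coeff_weilDecoration_le_stalkMap {E E' : X.Modules} (hE : IsReflexive E)
    (hE' : IsReflexive E') (μ : E ⟶ E') (P : PrimeDivisor X) (e : genericStalk E) :
    coeff P (weilDecoration E e) ≤
      coeff P (weilDecoration E' (stalkMap μ (genericPoint X) e)) :=
  (coeff_weilDecoration_le_iff hE hE' P e _).mpr fun f hf => by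
    rw [← stalkMap_smul]
    exact hf.stalkMap μ

/-- The inequality `≤` is automatic, so only `≥` matters. The multiplier `1` gives one direction;
the other applies the condition to `f • v`. -/
lemma coeff_weilDecoration_eq_stalkMap_iff {E' E : X.Modules} (hE' : IsReflexive E')
    (hE : IsReflexive E) (ι : E' ⟶ E) (P : PrimeDivisor X) :
    (∀ v : genericStalk E', coeff P (weilDecoration E' v) =
      coeff P (weilDecoration E (stalkMap ι (genericPoint X) v))) ↔
    ∀ v : genericStalk E', IsRegularAt E P.1 (stalkMap ι (genericPoint X) v) →
      IsRegularAt E' P.1 v := by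
  refine ⟨fun h v hv => ?_, fun h v => ?_⟩
  · have := (coeff_weilDecoration_le_iff hE hE' P _ v).mp (h v).ge 1
    rw [one_smul, one_smul] at this
    exact this hv
  · refine le_antisymm (coeff_weilDecoration_le_stalkMap hE' hE ι P v)
      ((coeff_weilDecoration_le_iff hE hE' P _ v).mpr fun f hf => h _ ?_)
    rwa [stalkMap_smul]

/-- By exactness at `P` and at `η`, the kernel of the map on cokernel stalks is `(E_P ∩ E'_η) /
E'_P`. -/
lemma toGenericStalk_cokernel_injective_iff {E' E : X.Modules} (hE' : IsReflexive E')
    (hE : IsReflexive E) (ι : E' ⟶ E) [Mono ι] (P : PrimeDivisor X) :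
    Function.Injective (toGenericStalk (Limits.cokernel ι) P.1) ↔
      ∀ v : genericStalk E', coeff P (weilDecoration E' v) =
        coeff P (weilDecoration E (stalkMap ι (genericPoint X) v)) := by
  have := hE.isIso_toDoubleDual
  have hker := Abelian.monoIsKernelOfCokernel _ (Limits.cokernelIsCokernel ι)
  have hw := Limits.cokernel.condition ι
  rw [coeff_weilDecoration_eq_stalkMap_iff hE' hE]
  refine ⟨fun h v ⟨x, hx⟩ => ?_, fun h => (injective_iff_map_eq_zero _).mpr fun y hy => ?_⟩
  · have h0 : stalkMap (Limits.cokernel.π ι) P.1 x = 0 := h (by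
      rw [← stalkMap_toGenericStalk, hx, stalkMap_stalkMap_eq_zero hw, map_zero])
    obtain ⟨x', rfl⟩ := exists_stalkMap_eq_of_isLimit _ _ hw hker h0
    refine ⟨x', stalkMap_injective ι _ ?_⟩
    rw [stalkMap_toGenericStalk, hx]
  · obtain ⟨x, rfl⟩ := stalkMap_surjective (Limits.cokernel.π ι) P.1 y
    rw [← stalkMap_toGenericStalk] at hy
    obtain ⟨v, hv⟩ := exists_stalkMap_eq_of_isLimit _ _ hw hker hy
    obtain ⟨x', rfl⟩ := h v ⟨x, hv.symm⟩
    rw [stalkMap_toGenericStalk] at hv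
    rw [← toGenericStalk_injective E P.1 hv, stalkMap_stalkMap_eq_zero hw]

/-- As `E''` need not be quasi-coherent, `E''_P → E''_η` may fail to be injective. Instead a nonzero
`r` moves `v` into `E'_P`, whence `r • φ(x) = 0` in `E''_P`, and torsion-freeness gives `φ(x) = 0`.
-/
lemma coeff_weilDecoration_eq_of_isTorsionFree {E' E E'' : X.Modules} (hE' : IsReflexive E')
    (hE : IsReflexive E) (ι : E' ⟶ E) (φ : E ⟶ E'') (w : ι ≫ φ = 0)
    (h : Limits.IsLimit (Limits.KernelFork.ofι ι w)) (hE'' : IsTorsionFree E'')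
    (P : PrimeDivisor X) (v : genericStalk E') : coeff P (weilDecoration E' v) =
      coeff P (weilDecoration E (stalkMap ι (genericPoint X) v)) := by
  have := hE.isIso_toDoubleDual
  have : Mono ι := Limits.mono_of_isLimit_fork h
  revert v
  rw [coeff_weilDecoration_eq_stalkMap_iff hE' hE]
  rintro v ⟨x, hx⟩
  obtain ⟨r, hr, y, hy⟩ := exists_smul_isRegularAt hE'.isCoherent P.1 v
  have hrx : r • x = stalkMap ι P.1 y := toGenericStalk_injective E P.1 (by
    rw [toGenericStalk_smul, hx, ← stalkMap_toGenericStalk, hy, stalkMap_smul])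
  have h0 : r • stalkMap φ P.1 x = 0 := by
    rw [← stalkMap_smul, hrx, stalkMap_stalkMap_eq_zero w]
  have := hE'' P.1
  obtain ⟨x', rfl⟩ := exists_stalkMap_eq_of_isLimit _ _ w h
    ((smul_eq_zero_iff_right hr).mp h0)
  refine ⟨x', stalkMap_injective ι _ ?_⟩
  rw [stalkMap_toGenericStalk, hx]

/-- The hypothesis `h0` is needed when there are no prime divisors: coefficients then cannot tell
`∞` from `0`. -/
lemma weilDecoration_eq_of_forall_coeff {E E' : X.Modules} (hE : IsReflexive E)
    (hE' : IsReflexive E') {e : genericStalk E} {e' : genericStalk E'} (h0 : e = 0 ↔ e' = 0)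
    (h : ∀ P, coeff P (weilDecoration E e) = coeff P (weilDecoration E' e')) :
    weilDecoration E e = weilDecoration E' e' := by
  by_cases he : e = 0
  · rw [he, h0.mp he, weilDecoration_zero, weilDecoration_zero]
  · obtain ⟨D, hD, -⟩ := hE.weilDecoration_eq he
    obtain ⟨D', hD', -⟩ := hE'.weilDecoration_eq (h0.not.mp he)
    rw [hD, hD']
    refine congrArg _ (Finsupp.ext fun P => ?_)
    have := h P
    rw [hD, hD'] at this
    exact WithTop.coe_injective this

lemma stalkMap_surjective_iff_isGreatest {E E' : X.Modules} (hE : IsReflexive E)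
    (hE' : IsReflexive E') (μ : E ⟶ E') (P : PrimeDivisor X) :
    Function.Surjective (stalkMap μ P.1) ↔ ∀ e' : genericStalk E',
      IsGreatest {n : WithTop ℤ | ∃ e : genericStalk E,
        stalkMap μ (genericPoint X) e = e' ∧ coeff P (weilDecoration E e) = n}
        (coeff P (weilDecoration E' e')) := by
  have := hE'.isIso_toDoubleDual
  refine ⟨fun h e' => ⟨?_, ?_⟩, fun h x' => ?_⟩
  · by_cases he' : e' = 0
    · exact ⟨0, by rw [map_zero, he'], by rw [he', weilDecoration_zero, weilDecoration_zero]⟩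
    obtain ⟨D', hD', hdiv⟩ := hE'.weilDecoration_eq he'
    -- With this order `f • e'` just lies in `E'_P`. Lifting it to `E_P` and dividing by `f` gives a
    -- preimage whose coefficient attains the bound.
    obtain ⟨f, hf, hfP⟩ := exists_ord_eq P (- D' P)
    obtain ⟨x', hx'⟩ := (hE'.isDivisorOf_iff.mp hdiv P f hf).mpr (by lia)
    obtain ⟨x, rfl⟩ := h x'
    rw [← stalkMap_toGenericStalk] at hx'
    have he : stalkMap μ (genericPoint X) (f⁻¹ • toGenericStalk E P.1 x) = e' := by
      rw [stalkMap_smul, hx', inv_smul_smul_genericStalk hf]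
    refine ⟨_, he, le_antisymm (he ▸ coeff_weilDecoration_le_stalkMap hE hE' μ P _) ?_⟩
    have h1 := (hE.isRegularAt_smul_iff P (f⁻¹ • toGenericStalk E P.1 x) hf).mp
      ⟨x, by rw [← mul_smul, mul_inv_cancel₀ hf, one_smul]⟩
    rw [hfP, neg_neg] at h1
    rw [hD']
    exact h1
  · rintro _ ⟨e, rfl, rfl⟩
    exact coeff_weilDecoration_le_stalkMap hE hE' μ P e
  · obtain ⟨e, he, hcoeff⟩ := (h (toGenericStalk E' P.1 x')).1
    have h1 := (coeff_weilDecoration_le_iff hE' hE P (toGenericStalk E' P.1 x') e).mp hcoeff.ge 1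
    rw [one_smul, one_smul] at h1
    obtain ⟨x, rfl⟩ := h1 ⟨x', rfl⟩
    rw [stalkMap_toGenericStalk] at he
    exact ⟨x, toGenericStalk_injective E' P.1 he⟩

lemma isLUB_weilDecoration {E E' : X.Modules} (hE : IsReflexive E) (hE' : IsReflexive E')
    (μ : E ⟶ E') (e' : genericStalk E') (h : ∀ P : PrimeDivisor X,
      IsGreatest {n : WithTop ℤ | ∃ e : genericStalk E,
        stalkMap μ (genericPoint X) e = e' ∧ coeff P (weilDecoration E e) = n}
        (coeff P (weilDecoration E' e'))) :
    IsLUB {D : WithTop (WeilDivisor X) | ∃ e : genericStalk E,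
      stalkMap μ (genericPoint X) e = e' ∧ weilDecoration E e = D} (weilDecoration E' e') := by
  by_cases he' : e' = 0
  · rw [he', weilDecoration_zero]
    exact ⟨fun _ _ => le_top, fun B hB => hB ⟨0, map_zero _, weilDecoration_zero E⟩⟩
  obtain ⟨D', hD', -⟩ := hE'.weilDecoration_eq he'
  have key (e : genericStalk E) (he : stalkMap μ (genericPoint X) e = e') :
      ∃ D : WeilDivisor X, weilDecoration E e = D := by
    obtain ⟨D, hD, -⟩ := hE.weilDecoration_eq (e := e) (fun h0 => he' (by rw [← he, h0, map_zero]))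
    exact ⟨D, hD⟩
  rw [hD']
  refine ⟨?_, fun B hB => ?_⟩
  · rintro _ ⟨e, he, rfl⟩
    obtain ⟨D, hD⟩ := key e he
    rw [hD]
    refine WithTop.coe_le_coe.mpr fun P => ?_
    have := (h P).2 ⟨e, he, rfl⟩
    rw [hD, hD'] at this
    exact WithTop.coe_le_coe.mp this
  · induction B with
    | top => exact le_top
    | coe B =>
      refine WithTop.coe_le_coe.mpr fun P => ?_
      -- The maximizing lift may vary with `P`; this suffices since the order on divisors is
      -- coefficientwise.
      obtain ⟨e, he, hP⟩ := (h P).1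
      obtain ⟨D, hD⟩ := key e he
      have hDB : D ≤ B := WithTop.coe_le_coe.mp (hD ▸ hB ⟨e, he, rfl⟩)
      rw [hD, hD'] at hP
      have hP' : D P = D' P := WithTop.coe_injective hP
      exact hP' ▸ hDB P

end Comparison

end WeilDeco

theorem theoremB {k : Type u} [Field k] [IsAlgClosed k] [CharZero k] (V : NormalVariety k) :
    -- the Weil decoration of a reflexive sheaf is well defined
    (∀ E : V.X.Modules, IsReflexive E → ∀ e : genericStalk E, e ≠ 0 →
      ∃! D : WeilDivisor V.X, IsDivisorOf E e D) ∧
    -- (i) subsheaves `ι : E' ⊆ E`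
    (∀ (E' E : V.X.Modules) (ι : E' ⟶ E) [Mono ι], IsReflexive E' → IsReflexive E →
      (∀ P : PrimeDivisor V.X,
        Function.Injective (toGenericStalk (Limits.cokernel ι) P.1) ↔
          ∀ v : genericStalk E',
            coeff P (weilDecoration E' v) =
              coeff P (weilDecoration E (stalkMap ι (genericPoint V.X) v))) ∧
      (∀ (E'' : V.X.Modules) (φ : E ⟶ E'') (w : ι ≫ φ = 0),
        Nonempty (Limits.IsLimit (Limits.KernelFork.ofι ι w)) → IsTorsionFree E'' →
          ∀ v : genericStalk E',
            weilDecoration E' v = weilDecoration E (stalkMap ι (genericPoint V.X) v))) ∧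
    -- (ii) morphisms `μ : E ⟶ E'`
    (∀ (E E' : V.X.Modules) (μ : E ⟶ E'), IsReflexive E → IsReflexive E' →
      (∀ P : PrimeDivisor V.X,
        Function.Surjective (stalkMap μ P.1) ↔
          ∀ e' : genericStalk E',
            IsGreatest {n : WithTop ℤ | ∃ e : genericStalk E,
                stalkMap μ (genericPoint V.X) e = e' ∧ coeff P (weilDecoration E e) = n}
              (coeff P (weilDecoration E' e'))) ∧
      (Epi μ → ∀ e' : genericStalk E',
        (∀ P : PrimeDivisor V.X,
          IsGreatest {n : WithTop ℤ | ∃ e : genericStalk E,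
              stalkMap μ (genericPoint V.X) e = e' ∧ coeff P (weilDecoration E e) = n}
            (coeff P (weilDecoration E' e'))) ∧
        IsLUB {D : WithTop (WeilDivisor V.X) | ∃ e : genericStalk E,
            stalkMap μ (genericPoint V.X) e = e' ∧ weilDecoration E e = D}
          (weilDecoration E' e'))) := by
  have : CompactSpace V.X := QuasiCompact.compactSpace_of_compactSpace V.str
  refine ⟨fun E hE e he => hE.existsUnique_isDivisorOf he,
    fun E' E ι _ hE' hE => ⟨fun P => toGenericStalk_cokernel_injective_iff hE' hE ι P,
      fun E'' φ w ⟨hlim⟩ htf v => weilDecoration_eq_of_forall_coeff hE' hE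
        (map_eq_zero_iff _ (stalkMap_injective ι _)).symm fun P =>
          coeff_weilDecoration_eq_of_isTorsionFree hE' hE ι φ w hlim htf P v⟩,
    fun E E' μ hE hE' => ⟨fun P => stalkMap_surjective_iff_isGreatest hE hE' μ P,
      fun _ e' => ?_⟩⟩
  have h (P : PrimeDivisor V.X) :=
    (stalkMap_surjective_iff_isGreatest hE hE' μ P).mp (stalkMap_surjective μ P.1) e'
  exact ⟨h, isLUB_weilDecoration hE hE' μ e' h⟩
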